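/- Let $p$ be a prime. For a finite group $X$, let $\operatorname{Irr}(X)$ be the set of complex irreducible characters of $X$ and let $\mathcal C(X)=\mathbb Z\operatorname{Irr}(X)$ be the abelian group of virtual characters of $X$. If $Y\le X$, let $\operatorname{Ind}_Y^X:\mathcal C(Y)\to\mathcal C(X)$ and $\operatorname{Res}^X_Y:\mathcal C(X)\to\mathcal C(Y)$ be the induction and restriction maps. For a $p$-subgroup $P$ of $X$ and a family $\mathcal S$ of subgroups of $P$ that is closed under taking subgroups, let $\mathcal I(X,P,\mathcal S)$ be the subgroup of $\mathcal C(X)$ generated by all $\operatorname{Ind}_L^X\phi$ with $\phi\in\mathcal C(L)$, where $L$ runs over the subgroups of $X$ such that $L\cap P$ is a Sylow $p$-subgroup of $L$ and $L\cap P\in\mathcal S$. **Theorem.** Let $G$ be a finite group, let $P$ be a Sylow $p$-subgroup of $G$, and let $H$ be a subgroup of $G$ with $N_G(P)\le H\le G$. Set $$\mathcal S=\mathcal S(G,P,H)=\{\,Q\le P \mid Q\subseteq tPt^{-1}\text{ for some } t\in G\setminus H\,\}.$$ Then: (i) $\operatorname{Ind}_H^G(\mathcal I(H,P,\mathcal S))\subseteq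 \mathcal I(G,P,\mathcal S)$; (ii) $\operatorname{Res}^G_H(\mathcal I(G,P,\mathcal S))\subseteq \mathcal I(H,P,\mathcal S)$; (iii) the maps $\operatorname{Res}^G_H$ and $\operatorname{Ind}_H^G$ induce mutually inverse isomorphisms between the abelian groups $\mathcal C(G)/\mathcal I(G,P,\mathcal S)$ and $\mathcal C(H)/\mathcal I(H,P,\mathcal S)$. -/

import Mathlib

namespace McKay

/-- The set `Irr(G)` of irreducible complex characters of `G`, as functions on `G`. -/
def irr (G : Type*) [Group G] : Set (G → ℂ) :=
  {χ | ∃ (V : Type) (_ : AddCommGroup V) (_ : Module ℂ V) (_ : FiniteDimensional ℂ V)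
    (ρ : Representation ℂ G V), ρ.IsIrreducible ∧ ρ.character = χ}

/-- The abelian group `𝓒(G) = ℤ Irr(G)` of virtual characters of `G`. -/
def virtualChar (G : Type*) [Group G] : AddSubgroup (G → ℂ) :=
  AddSubgroup.closure (irr G)

/-- The trace of an endomorphism preserving two complementary subspaces. -/
theorem trace_of_isCompl {V : Type*} [AddCommGroup V] [Module ℂ V] [FiniteDimensional ℂ V]
    (f : V →ₗ[ℂ] V) {A B : Submodule ℂ V} (h : IsCompl A B)
    (hA : ∀ v ∈ A, f v ∈ A) (hB : ∀ v ∈ B, f v ∈ B) :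
    LinearMap.trace ℂ V f =
      LinearMap.trace ℂ A (f.restrict hA) + LinearMap.trace ℂ B (f.restrict hB) := by
  rw [← LinearMap.trace_prodMap', ← LinearMap.trace_conj' _ (Submodule.prodEquivOfIsCompl A B h)]
  congr 1
  apply LinearMap.ext
  intro v
  obtain ⟨w, rfl⟩ := (Submodule.prodEquivOfIsCompl A B h).surjective v
  simp [LinearEquiv.conj_apply]

theorem character_mem_aux {G : Type*} [Group G] [Finite G] (n : ℕ) :
    ∀ (V : Type) [AddCommGroup V] [Module ℂ V] [FiniteDimensional ℂ V]
      (ρ : Representation ℂ G V), Module.finrank ℂ V = n → ρ.character ∈ virtualChar G := by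
  induction n using Nat.strong_induction_on with
  | _ n ih =>
    intro V _ _ _ ρ hn
    by_cases hirr : ρ.IsIrreducible
    · exact AddSubgroup.subset_closure ⟨V, _, _, ‹_›, ρ, hirr, rfl⟩
    by_cases hsub : Subsingleton V
    · have : ρ.character = 0 := by
        funext g
        have h0 : ρ g = 0 := by
          apply LinearMap.ext
          intro v
          exact Subsingleton.elim _ _
        simp [Representation.character, h0]
      rw [this]
      exact zero_mem _
    obtain ⟨σ, hbot, htop⟩ : ∃ σ : Subrepresentation ρ, σ ≠ ⊥ ∧ σ ≠ ⊤ := by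
      by_contra! hcon
      apply hirr
      have hnt : (⊥ : Subrepresentation ρ) ≠ ⊤ := by
        intro h
        apply hsub
        have h2 : (⊥ : Submodule ℂ V) = ⊤ := congrArg Subrepresentation.toSubmodule h
        exact (Submodule.subsingleton_iff ℂ).1 (subsingleton_of_bot_eq_top h2)
      exact { exists_pair_ne := ⟨_, _, hnt⟩
              eq_bot_or_eq_top := fun σ => or_iff_not_imp_left.2 (hcon σ) }
    obtain ⟨τ, hτ⟩ := exists_isCompl σ
    have hc : IsCompl σ.toSubmodule τ.toSubmodule := by
      constructor
      · rw [disjoint_iff]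
        exact congrArg Subrepresentation.toSubmodule hτ.inf_eq_bot
      · rw [codisjoint_iff]
        exact congrArg Subrepresentation.toSubmodule hτ.sup_eq_top
    have hσ1 : Module.finrank ℂ σ.toSubmodule < n := by
      rw [← hn]
      exact Submodule.finrank_lt fun h => htop (Subrepresentation.toSubmodule_injective h)
    have hτ1 : Module.finrank ℂ τ.toSubmodule < n := by
      have h1 := Submodule.finrank_add_eq_of_isCompl hc
      have h2 : 0 < Module.finrank ℂ σ.toSubmodule := by
        rw [Module.finrank_pos_iff, Submodule.nontrivial_iff_ne_bot]
        exact fun h => hbot (Subrepresentation.toSubmodule_injective h)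
      omega
    have hsum : ρ.character = σ.toRepresentation.character + τ.toRepresentation.character := by
      funext g
      exact trace_of_isCompl (ρ g) hc (σ.apply_mem_toSubmodule g) (τ.apply_mem_toSubmodule g)
    rw [hsum]
    exact add_mem (ih _ hσ1 _ _ rfl) (ih _ hτ1 _ _ rfl)

/-- The character of any finite-dimensional complex representation is a virtual character. -/
theorem character_mem {G : Type*} [Group G] [Finite G] {V : Type*} [AddCommGroup V] [Module ℂ V]
    [FiniteDimensional ℂ V] (ρ : Representation ℂ G V) : ρ.character ∈ virtualChar G := by
  let e : V ≃ₗ[ℂ] (Fin (Module.finrank ℂ V) → ℂ) := (Module.finBasis ℂ V).equivFun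
  let ρ' : Representation ℂ G (Fin (Module.finrank ℂ V) → ℂ) :=
    { toFun := fun g => e.conj (ρ g)
      map_one' := by
        rw [map_one]
        exact LinearEquiv.conj_id e
      map_mul' := fun g h => by
        rw [map_mul]
        exact LinearEquiv.conj_comp e _ _ }
  have h : ρ.character = ρ'.character := by
    funext g
    exact (LinearMap.trace_conj' (ρ g) e).symm
  rw [h]
  exact character_mem_aux _ _ ρ' rfl

/-- Restriction of functions from `G` to a subgroup `H`. -/
def resFun {G : Type*} [Group G] (H : Subgroup G) : (G → ℂ) →+ (H → ℂ) where
  toFun χ h := χ h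
  map_zero' := rfl
  map_add' _ _ := rfl

open scoped Classical in
/-- Induction of (class) functions from a subgroup `H` to `G`:
`(Ind φ)(g) = |H|⁻¹ ∑_{x ∈ G} φ°(x g x⁻¹)`, where `φ°` is `φ` extended by zero outside `H`. -/
noncomputable def indFun {G : Type*} [Group G] [Finite G] (H : Subgroup G) :
    (H → ℂ) →+ (G → ℂ) where
  toFun φ g := (Nat.card H : ℂ)⁻¹ *
    ∑ᶠ x : G, if h : x * g * x⁻¹ ∈ H then φ ⟨x * g * x⁻¹, h⟩ else 0
  map_zero' := by
    funext g
    simp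
  map_add' φ ψ := by
    funext g
    simp only [Pi.add_apply]
    rw [← mul_add, ← finsum_add_distrib (Set.toFinite _) (Set.toFinite _)]
    congr 1
    apply finsum_congr
    intro x
    split_ifs <;> simp

theorem resFun_mem {G : Type*} [Group G] [Finite G] (H : Subgroup G) {χ : G → ℂ}
    (hχ : χ ∈ virtualChar G) : resFun H χ ∈ virtualChar H := by
  have hle : virtualChar G ≤ (virtualChar H).comap (resFun H) := by
    refine (AddSubgroup.closure_le _).2 ?_
    rintro _ ⟨V, _, _, _, ρ, -, rfl⟩
    exact character_mem (ρ.comp H.subtype)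
  exact hle hχ

/-- The formula for induction gives the character of the (co)induced representation. -/
theorem indFun_character {G : Type*} [Group G] [Finite G] (H : Subgroup G) {V : Type*}
    [AddCommGroup V] [Module ℂ V] [FiniteDimensional ℂ V] (ρ : Representation ℂ H V) :
    indFun H ρ.character = (Representation.coind H.subtype ρ).character := by
  classical
  have := Fintype.ofFinite G
  have := Fintype.ofFinite H
  funext g
  let T : (G → V) →ₗ[ℂ] (G → V) := LinearMap.pi fun x =>
    (Nat.card H : ℂ)⁻¹ • ∑ h : H, (ρ h⁻¹) ∘ₗ LinearMap.proj ((h : G) * x * g)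
  have hT : ∀ (f : G → V) (x : G),
      T f x = (Nat.card H : ℂ)⁻¹ • ∑ h : H, ρ h⁻¹ (f ((h : G) * x * g)) := by
    intro f x
    simp [T]
  have hmem : ∀ f, T f ∈ Representation.coindV H.subtype ρ := by
    intro f k x
    rw [hT, hT, map_smul, map_sum]
    congr 1
    refine Fintype.sum_equiv (Equiv.mulRight k) _ _ fun h => ?_
    simp only [Equiv.coe_mulRight, Subgroup.coe_subtype, mul_inv_rev, Subgroup.coe_mul, map_mul,
      Module.End.mul_apply, mul_assoc]
    rw [← Module.End.mul_apply, ← map_mul, mul_inv_cancel, map_one, Module.End.one_apply]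
  have hres : ((Representation.coind H.subtype ρ).character g) = LinearMap.trace ℂ _ T := by
    rw [← LinearMap.trace_restrict_eq_of_forall_mem _ T hmem]
    unfold Representation.character
    congr 1
    apply LinearMap.ext
    rintro ⟨f, hf⟩
    apply Subtype.ext
    funext x
    change f (x * g) = T f x
    rw [hT]
    have h1 : ∀ h : H, ρ h⁻¹ (f ((h : G) * x * g)) = f (x * g) := by
      intro h
      have := hf h (x * g)
      rw [Subgroup.coe_subtype, ← mul_assoc] at this
      rw [this, ← Module.End.mul_apply, ← map_mul, inv_mul_cancel, map_one, Module.End.one_apply]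
    simp only [h1, Finset.sum_const, Finset.card_univ, ← Nat.card_eq_fintype_card]
    rw [← Nat.cast_smul_eq_nsmul ℂ, smul_smul, inv_mul_cancel₀, one_smul]
    exact_mod_cast Nat.card_pos.ne'
  rw [hres]
  have hdecomp : T = ∑ x : G, T ∘ₗ (LinearMap.single ℂ (fun _ : G => V) x ∘ₗ LinearMap.proj x) := by
    apply LinearMap.ext
    intro f
    simp only [LinearMap.sum_apply, LinearMap.comp_apply]
    rw [← map_sum]
    congr 1
    funext y
    simp [Pi.single_apply]
  rw [hdecomp, map_sum]
  change (Nat.card H : ℂ)⁻¹ * ∑ᶠ x : G, _ = _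
  rw [finsum_eq_sum_of_fintype, Finset.mul_sum]
  refine Finset.sum_congr rfl fun x _ => ?_
  rw [← LinearMap.comp_assoc, LinearMap.trace_comp_comm']
  split_ifs with hx
  · rw [Representation.character, ← smul_eq_mul, ← map_smul]
    congr 1
    apply LinearMap.ext
    intro v
    change _ = T (Pi.single x v) x
    rw [hT, LinearMap.smul_apply]
    congr 1
    rw [Finset.sum_eq_single (⟨x * g * x⁻¹, hx⟩ : H)⁻¹]
    · simp [mul_assoc]
    · intro h _ hne
      rw [Pi.single_eq_of_ne, map_zero]
      intro heq
      apply hne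
      apply Subtype.ext
      have : (h : G) = x * (x * g)⁻¹ := by
        rw [eq_mul_inv_iff_mul_eq, ← mul_assoc, heq]
      simp [this, mul_assoc]
    · simp
  · have : (LinearMap.proj x : (G → V) →ₗ[ℂ] V) ∘ₗ T ∘ₗ LinearMap.single ℂ (fun _ : G => V) x
        = 0 := by
      apply LinearMap.ext
      intro v
      change T (Pi.single x v) x = 0
      rw [hT, Finset.sum_eq_zero, smul_zero]
      intro h _
      rw [Pi.single_eq_of_ne, map_zero]
      intro heq
      apply hx
      have : x * g * x⁻¹ = ((h⁻¹ : H) : G) := by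
        rw [mul_inv_eq_iff_eq_mul, Subgroup.coe_inv, eq_inv_mul_iff_mul_eq, ← mul_assoc, heq]
      rw [this]
      exact SetLike.coe_mem _
    rw [this, map_zero, mul_zero]

theorem indFun_mem {G : Type*} [Group G] [Finite G] (H : Subgroup G) {φ : H → ℂ}
    (hφ : φ ∈ virtualChar H) : indFun H φ ∈ virtualChar G := by
  have hle : virtualChar H ≤ (virtualChar G).comap (indFun H) := by
    refine (AddSubgroup.closure_le _).2 ?_
    rintro _ ⟨V, _, _, _, ρ, -, rfl⟩
    change indFun H ρ.character ∈ virtualChar G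
    rw [indFun_character]
    exact character_mem _
  exact hle hφ

/-- The restriction map `Res : 𝓒(G) → 𝓒(H)`. -/
def res {G : Type*} [Group G] [Finite G] (H : Subgroup G) : virtualChar G →+ virtualChar H :=
  ((resFun H).comp (virtualChar G).subtype).codRestrict (virtualChar H)
    fun χ => resFun_mem H χ.2

/-- The induction map `Ind : 𝓒(H) → 𝓒(G)`. -/
noncomputable def ind {G : Type*} [Group G] [Finite G] (H : Subgroup G) :
    virtualChar H →+ virtualChar G :=
  ((indFun H).comp (virtualChar H).subtype).codRestrict (virtualChar G)
    fun φ => indFun_mem H φ.2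

/-- The intersection set `𝓢(G, P, H)`: the subgroups `Q` of `P` that are contained in the conjugate
`t P t⁻¹` for some `t ∈ G` outside `H`. -/
def intersectionSet {G : Type*} [Group G] (P H : Subgroup G) : Set (Subgroup G) :=
  {Q | Q ≤ P ∧ ∃ t : G, t ∉ H ∧ Q ≤ P.map (MulAut.conj t).toMonoidHom}

/-- The subgroup `𝓘(G, P, 𝓢)` of `𝓒(G)` generated by the `Ind_L^G φ` with `φ ∈ 𝓒(L)`, where `L`
runs over the subgroups of `G` such that `L ∩ P` is a Sylow `p`-subgroup of `L` and lies in `𝓢`. -/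
def inducedSubgroup {G : Type*} [Group G] [Finite G] (p : ℕ) (P : Subgroup G)
    (S : Set (Subgroup G)) : AddSubgroup (virtualChar G) :=
  AddSubgroup.closure {χ | ∃ L : Subgroup G,
    (∃ T : Sylow p L, (T : Subgroup L) = P.subgroupOf L) ∧ L ⊓ P ∈ S ∧
    ∃ φ : virtualChar L, ind L φ = χ}

/-- A family of subgroups of `G`, viewed as a family of subgroups of the subgroup `H`. (For the
family `𝓢` of subgroups of `P ≤ H` considered here, no member is lost.) -/
def familyIn {G : Type*} [Group G] (H : Subgroup G) (S : Set (Subgroup G)) : Set (Subgroup H) :=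
  {Q | Q.map H.subtype ∈ S}

end McKay

/-! The families attached to `P` are replaced by an intrinsic condition on a subgroup `L`, namely
that each of its `p`-subgroups fixes at least two points of `G ⧸ H` (`FixesTwo`). By Sylow's theorem
the characters induced from such `L` span exactly `𝓘(G, P, 𝓢)`, and those induced to `H` from such
`L ≤ H` span `𝓘(H, P, 𝓢)` (`mem_indSpan_of_mem_inducedSubgroup`,
`mem_inducedSubgroup_of_mem_indSpan`). The condition passes to subgroups and conjugates, so (i) is
transitivity of induction and (ii) is Mackey's formula. The projection formula makes these spans
ideals.

For (iii), `Res Ind φ - φ` is the Mackey sum over the cosets other than the base one, and the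
stabilizer in `H` of such a coset also fixes the base coset (`resFun_indFun_sub_mem`). In the other
direction `Ind Res χ - χ = (Ind 1 - 1) χ`, so only `θ = Ind 1 - 1` matters
(`indFun_one_sub_one_mem`). As in the Brauer–Solomon induction theorem, the integer-valued virtual
characters `f` with `f θ` in the span contain `1` once they contain `Ind_L 1` for every
`q`-hyperelementary `L`, `q` any prime. This reduces the claim to the restrictions of `θ` to such
`L` (`cosetChar_sub_one_mem`).

Let `L` have a normal abelian `q'`-subgroup `C` with `L ⧸ C` a `q`-group, and let `T` be a Sylow
`p`-subgroup of `L`. One may assume that `T` fixes exactly one coset `x₀`. Orbits of `L` not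
containing `x₀` contribute elements of the span. If `p ≠ q`, then `T` is normal in `L` and the orbit
of `x₀` is a point. If `p = q`, then `C` is transitive on that orbit, and its permutation character
is split according to the linear characters of `C`: the trivial one contributes `1`, the others
contribute `0` or functions induced from stabilizers satisfying `FixesTwo`. -/

namespace McKay

/-! ### Virtual characters as functions -/

theorem virtualChar_conj {G : Type*} [Group G] {χ : G → ℂ} (hχ : χ ∈ virtualChar G) (x g : G) :
    χ (x * g * x⁻¹) = χ g := by
  induction hχ using AddSubgroup.closure_induction with
  | mem χ h =>
    obtain ⟨V, _, _, _, ρ, -, rfl⟩ := h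
    exact ρ.char_conj g x
  | zero => rfl
  | add χ ψ _ _ h1 h2 => simp only [Pi.add_apply, h1, h2]
  | neg χ _ h => simp only [Pi.neg_apply, h]

theorem virtualChar_comp {G K : Type*} [Group G] [Group K] [Finite K] (f : K →* G) {χ : G → ℂ}
    (hχ : χ ∈ virtualChar G) : (fun k => χ (f k)) ∈ virtualChar K := by
  induction hχ using AddSubgroup.closure_induction with
  | mem χ h =>
    obtain ⟨V, _, _, _, ρ, -, rfl⟩ := h
    exact character_mem (ρ.comp f)
  | zero => exact zero_mem _
  | add χ ψ _ _ h1 h2 => exact add_mem h1 h2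
  | neg χ _ h => exact neg_mem h

theorem virtualChar_one {G : Type*} [Group G] [Finite G] : (1 : G → ℂ) ∈ virtualChar G := by
  have : (Representation.trivial ℂ G ℂ).character = 1 := by
    funext g
    simp [Representation.character]
  exact this ▸ character_mem _

theorem virtualChar_mul {G : Type*} [Group G] [Finite G] {χ ψ : G → ℂ}
    (hχ : χ ∈ virtualChar G) (hψ : ψ ∈ virtualChar G) : χ * ψ ∈ virtualChar G := by
  induction hχ using AddSubgroup.closure_induction with
  | mem χ h =>
    obtain ⟨V, _, _, _, ρ, -, rfl⟩ := h
    induction hψ using AddSubgroup.closure_induction with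
    | mem ψ h =>
      obtain ⟨W, _, _, _, σ, -, rfl⟩ := h
      rw [← Representation.char_tensor]
      exact character_mem _
    | zero => simp
    | add χ ψ _ _ h1 h2 => rw [mul_add]; exact add_mem h1 h2
    | neg χ _ h => rw [mul_neg]; exact neg_mem h
  | zero => simp
  | add χ ψ _ _ h1 h2 => rw [add_mul]; exact add_mem h1 h2
  | neg χ _ h => rw [neg_mul]; exact neg_mem h

/-! ### Induction along group homomorphisms -/

open scoped Classical in
/-- Induction of class functions along a group homomorphism. -/
noncomputable def indHom {K G : Type*} [Group K] [Group G] (f : K →* G) (φ : K → ℂ) : G → ℂ :=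
  fun g => (Nat.card K : ℂ)⁻¹ * ∑ᶠ x : G, ∑ᶠ k : K, if f k = x * g * x⁻¹ then φ k else 0

section indHom

variable {K M G : Type*} [Group K] [Group M] [Group G] [Finite K] [Finite M] [Finite G]

theorem indFun_eq_indHom (L : Subgroup G) (φ : L → ℂ) : indFun L φ = indHom L.subtype φ := by
  classical
  have := Fintype.ofFinite L
  funext g
  change (Nat.card L : ℂ)⁻¹ * _ = (Nat.card L : ℂ)⁻¹ * _
  congr 1
  refine finsum_congr fun x => ?_
  rw [finsum_eq_sum_of_fintype]
  split_ifs with h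
  · rw [Finset.sum_eq_single ⟨_, h⟩]
    · simp
    · intro k _ hk
      rw [if_neg]
      exact fun h' => hk (Subtype.ext h')
    · simp
  · refine (Finset.sum_eq_zero fun k _ => if_neg fun h' => h ?_).symm
    exact h' ▸ k.2

/-- Transitivity of induction. Translating `x` by `f y` makes the sum belonging to `y : K`
independent of `y`, so the sum over `y` only cancels the factor `|K|⁻¹`. -/
theorem indHom_comp (f : K →* G) (h : M →* K) (φ : M → ℂ) :
    indHom f (indHom h φ) = indHom (f.comp h) φ := by
  classical
  have := Fintype.ofFinite K
  have := Fintype.ofFinite M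
  have := Fintype.ofFinite G
  funext g
  simp only [indHom, finsum_eq_sum_of_fintype, MonoidHom.comp_apply]
  have key : ∀ y : K, ∑ x : G, ∑ k : K, ∑ m : M,
      (if f k = x * g * x⁻¹ then (if h m = y * k * y⁻¹ then φ m else 0) else 0) =
      ∑ x : G, ∑ m : M, if f (h m) = x * g * x⁻¹ then φ m else 0 := by
    intro y
    refine Fintype.sum_equiv (Equiv.mulLeft (f y)) _ _ fun x => ?_
    rw [Finset.sum_comm]
    refine Finset.sum_congr rfl fun m _ => ?_
    rw [Finset.sum_eq_single (y⁻¹ * h m * y)]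
    · rw [if_pos (by group : h m = y * (y⁻¹ * h m * y) * y⁻¹)]
      refine if_congr ?_ rfl rfl
      simp only [map_mul, map_inv, Equiv.coe_mulLeft, mul_inv_rev]
      constructor
      · intro e
        have : f (h m) = f y * ((f y)⁻¹ * f (h m) * f y) * (f y)⁻¹ := by group
        rw [this, e]
        group
      · intro e
        rw [e]
        group
    · intro k _ hk
      have hne : h m ≠ y * k * y⁻¹ := by
        intro e
        apply hk
        rw [e]
        group
      rw [if_neg hne, ite_self]
    · simp
  have e2 : ∀ x : G, (∑ k : K, if f k = x * g * x⁻¹ then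
      (Nat.card M : ℂ)⁻¹ * ∑ y : K, ∑ m : M, if h m = y * k * y⁻¹ then φ m else 0 else 0) =
      (Nat.card M : ℂ)⁻¹ * ∑ y : K, ∑ k : K, ∑ m : M,
      (if f k = x * g * x⁻¹ then (if h m = y * k * y⁻¹ then φ m else 0) else 0) := by
    intro x
    rw [Finset.sum_comm, Finset.mul_sum]
    refine Finset.sum_congr rfl fun k _ => ?_
    split_ifs <;> simp
  simp only [e2]
  rw [← Finset.mul_sum, Finset.sum_comm]
  simp only [key]
  rw [Finset.sum_const, Finset.card_univ, ← Nat.card_eq_fintype_card, nsmul_eq_mul]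
  have : (Nat.card K : ℂ) ≠ 0 := by exact_mod_cast Nat.card_pos.ne'
  field_simp

/-- The projection formula. It makes `indSpan` an ideal and reduces `Ind Res χ` to `Ind 1`. -/
theorem indHom_mul (f : K →* G) (φ : K → ℂ) {χ : G → ℂ} (hχ : ∀ x g, χ (x * g * x⁻¹) = χ g) :
    indHom f (φ * fun k => χ (f k)) = indHom f φ * χ := by
  classical
  have := Fintype.ofFinite K
  have := Fintype.ofFinite G
  funext g
  simp only [indHom, finsum_eq_sum_of_fintype, Pi.mul_apply, mul_assoc, Finset.sum_mul]
  congr 1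
  refine Finset.sum_congr rfl fun x _ => Finset.sum_congr rfl fun k _ => ?_
  split_ifs with h
  · rw [h, ← mul_assoc, hχ]
  · simp

/-- The substitution `x ↦ s⁻¹ x` absorbs the conjugation, so a subgroup may be replaced by a
conjugate without changing the induced function. -/
theorem indHom_conj_comp (s : G) (f : K →* G) (φ : K → ℂ) :
    indHom ((MulAut.conj s).toMonoidHom.comp f) φ = indHom f φ := by
  classical
  have := Fintype.ofFinite K
  have := Fintype.ofFinite G
  funext g
  simp only [indHom, finsum_eq_sum_of_fintype]
  congr 1
  refine Fintype.sum_equiv (Equiv.mulLeft s⁻¹) _ _ fun x => ?_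
  refine Finset.sum_congr rfl fun k _ => if_congr ?_ rfl rfl
  simp only [MonoidHom.comp_apply, MulEquiv.coe_toMonoidHom, MulAut.conj_apply,
    Equiv.coe_mulLeft, mul_inv_rev, inv_inv]
  constructor
  · intro e
    have : f k = s⁻¹ * (s * f k * s⁻¹) * s := by group
    rw [this, e]
    group
  · intro e
    rw [e]
    group

theorem indFun_range (f : K →* G) (hf : Function.Injective f) (φ : K → ℂ) :
    indFun f.range (fun k => φ ((MonoidHom.ofInjective hf).symm k)) = indHom f φ := by
  classical
  have := Fintype.ofFinite K
  have := Fintype.ofFinite G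
  have := Fintype.ofFinite f.range
  rw [indFun_eq_indHom]
  funext g
  simp only [indHom, finsum_eq_sum_of_fintype]
  rw [Nat.card_congr (MonoidHom.ofInjective hf).toEquiv]
  congr 1
  refine Finset.sum_congr rfl fun x _ => ?_
  refine (Fintype.sum_equiv (MonoidHom.ofInjective hf).toEquiv _ _ fun k => ?_).symm
  have e : (((MonoidHom.ofInjective hf) k : f.range) : G) = f k := rfl
  simp [e]

end indHom

/-! ### Sums over fixed points -/

theorem sum_smul_eq {L X : Type*} [Group L] [Fintype L] [MulAction L X] [Fintype X]
    [DecidableEq X] (x : X) [DecidablePred (· ∈ MulAction.orbit L x)] (φ : X → ℂ) :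
    ∑ y : L, φ (y • x) =
      Nat.card (MulAction.stabilizer L x) * ∑ z with z ∈ MulAction.orbit L x, φ z := by
  classical
  rw [← Finset.sum_fiberwise_of_maps_to (s := Finset.univ) (t := Finset.univ.filter
    (· ∈ MulAction.orbit L x)) (g := fun y : L => y • x)
    (fun y _ => by simp), Finset.mul_sum]
  refine Finset.sum_congr rfl fun z hz => ?_
  obtain ⟨y₀, rfl⟩ := (Finset.mem_filter.1 hz).2
  rw [Finset.sum_congr rfl (g := fun _ => φ (y₀ • x))
    (fun y hy => by rw [(Finset.mem_filter.1 hy).2]), Finset.sum_const, nsmul_eq_mul]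
  congr 2
  rw [Nat.card_eq_fintype_card, Fintype.card_subtype]
  refine Finset.card_bij' (fun y _ => y₀⁻¹ * y) (fun y _ => y₀ * y) ?_ ?_ ?_ ?_
  · intro y hy
    simp only [Finset.mem_filter, Finset.mem_univ, true_and] at hy
    simp [MulAction.mem_stabilizer_iff, mul_smul, hy]
  · intro y hy
    simp only [Finset.mem_filter, Finset.mem_univ, true_and, MulAction.mem_stabilizer_iff] at hy
    simp [mul_smul, hy]
  · simp
  · simp

-- By `ha`, the value at `y g y⁻¹` and `x` is the value at `g` and `y⁻¹ • x`. Grouping the `y` by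
-- this point, each point of the orbit occurs as often as the stabilizer has elements.
open scoped Classical in
theorem indFun_stabilizer {L X : Type*} [Group L] [Finite L] [MulAction L X] [Fintype X]
    [DecidableEq X]
    (a : L → X → ℂ) (ha : ∀ h g x, g • x = x → a (h * g * h⁻¹) (h • x) = a g x) (x : X) (g : L) :
    indFun (MulAction.stabilizer L x) (fun k => a k x) g =
      ∑ z with z ∈ MulAction.orbit L x, if g • z = z then a g z else 0 := by
  have := Fintype.ofFinite L
  change (Nat.card (MulAction.stabilizer L x) : ℂ)⁻¹ * ∑ᶠ y : L, _ = _
  rw [finsum_eq_sum_of_fintype]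
  have : ∀ y : L, (if h : y * g * y⁻¹ ∈ MulAction.stabilizer L x then a (y * g * y⁻¹) x else 0) =
      if g • (y⁻¹ • x) = y⁻¹ • x then a g (y⁻¹ • x) else 0 := by
    intro y
    have hiff : y * g * y⁻¹ ∈ MulAction.stabilizer L x ↔ g • (y⁻¹ • x) = y⁻¹ • x := by
      rw [MulAction.mem_stabilizer_iff, mul_smul, mul_smul, eq_inv_smul_iff]
    by_cases h : g • (y⁻¹ • x) = y⁻¹ • x
    · rw [dif_pos (hiff.2 h), if_pos h, ← ha y g _ h, smul_inv_smul]
    · rw [dif_neg (fun h' => h (hiff.1 h')), if_neg h]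
  simp only [this]
  rw [Fintype.sum_equiv (Equiv.inv L)
    (fun y => if g • (y⁻¹ • x) = y⁻¹ • x then a g (y⁻¹ • x) else 0)
    (fun y => if g • (y • x) = y • x then a g (y • x) else 0) (fun y => rfl),
    sum_smul_eq x (fun z => if g • z = z then a g z else 0), inv_mul_cancel_left₀]
  exact_mod_cast Nat.card_pos.ne'

/-- A sum over fixed points decomposes into functions induced from the point stabilizers. -/
theorem sum_fixed_mem {L X : Type*} [Group L] [Finite L] [MulAction L X] [Fintype X]
    [DecidableEq X]
    (a : L → X → ℂ) (ha : ∀ h g x, g • x = x → a (h * g * h⁻¹) (h • x) = a g x)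
    (B : AddSubgroup (L → ℂ))
    (hB : ∀ x, indFun (MulAction.stabilizer L x) (fun k => a k x) ∈ B) :
    (fun g => ∑ x : X, if g • x = x then a g x else 0) ∈ B := by
  classical
  have h : (fun g => ∑ x : X, if g • x = x then a g x else 0) =
      ∑ ω : MulAction.orbitRel.Quotient L X,
        indFun (MulAction.stabilizer L ω.out) (fun k => a k ω.out) := by
    funext g
    rw [Finset.sum_apply, ← Finset.sum_fiberwise (s := Finset.univ)
      (g := fun x : X => (Quotient.mk'' x : MulAction.orbitRel.Quotient L X))]
    refine Finset.sum_congr rfl fun ω _ => ?_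
    rw [indFun_stabilizer a ha]
    refine Finset.sum_congr ?_ fun _ _ => rfl
    ext x
    simp only [Finset.mem_filter, Finset.mem_univ, true_and]
    rw [← MulAction.orbitRel_apply]
    conv_lhs => rw [← Quotient.out_eq' ω]
    exact Quotient.eq''
  rw [h]
  exact sum_mem fun ω _ => hB _

/-! ### Homomorphisms under which every `p`-subgroup fixes two cosets -/

theorem exists_conj_mem_sylow {K : Type*} [Group K] [Finite K] {p : ℕ} [Fact p.Prime]
    (T : Sylow p K) {R : Subgroup K} (hR : IsPGroup p R) :
    ∃ k : K, ∀ r ∈ R, k⁻¹ * r * k ∈ T := by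
  obtain ⟨T', hT'⟩ := hR.exists_le_sylow
  obtain ⟨k, rfl⟩ := MulAction.exists_smul_eq K T T'
  refine ⟨k, fun r hr => ?_⟩
  have h := hT' hr
  rw [Sylow.coe_subgroup_smul, Subgroup.mem_pointwise_smul_iff_inv_smul_mem] at h
  simpa using! h

/-- Every `p`-subgroup of `K` fixes, through `j`, at least two cosets of `H`. -/
def FixesTwo {G : Type*} [Group G] (p : ℕ) (H : Subgroup G) {K : Type*} [Group K] (j : K →* G) :
    Prop :=
  ∀ R : Subgroup K, IsPGroup p R →
    ∃ y z : G ⧸ H, y ≠ z ∧ ∀ r ∈ R, j r • y = y ∧ j r • z = z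

section FixesTwo

variable {G : Type*} [Group G] {p : ℕ} {H : Subgroup G} {K M : Type*} [Group K] [Group M]

theorem FixesTwo.comp {j : K →* G} (hj : FixesTwo p H j) (f : M →* K) :
    FixesTwo p H (j.comp f) := by
  intro R hR
  obtain ⟨y, z, hyz, h⟩ := hj _ (hR.map f)
  exact ⟨y, z, hyz, fun r hr => h _ (Subgroup.mem_map_of_mem f hr)⟩

theorem FixesTwo.conj {j : K →* G} (hj : FixesTwo p H j) (s : G) :
    FixesTwo p H ((MulAut.conj s).toMonoidHom.comp j) := by
  intro R hR
  obtain ⟨y, z, hyz, h⟩ := hj R hR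
  refine ⟨s • y, s • z, fun e => hyz (smul_left_cancel s e), fun r hr => ?_⟩
  simp [mul_smul, h r hr]

theorem fixesTwo_of_fixed (j : K →* G) {y z : G ⧸ H} (hyz : y ≠ z)
    (hy : ∀ k, j k • y = y) (hz : ∀ k, j k • z = z) : FixesTwo p H j :=
  fun _ _ => ⟨y, z, hyz, fun r _ => ⟨hy r, hz r⟩⟩

/-- Every `p`-subgroup is conjugate into `T`, and the conjugating element translates the two cosets
to two others. -/
theorem fixesTwo_of_sylow [Finite K] [Fact p.Prime] (j : K →* G) (T : Sylow p K) {y z : G ⧸ H}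
    (hyz : y ≠ z) (h : ∀ r ∈ T, j r • y = y ∧ j r • z = z) : FixesTwo p H j := by
  intro R hR
  obtain ⟨k, hk⟩ := exists_conj_mem_sylow T hR
  refine ⟨j k • y, j k • z, fun e => hyz (smul_left_cancel _ e), fun r hr => ?_⟩
  have := h _ (hk r hr)
  simpa [mul_smul, inv_smul_eq_iff] using this

/-- The span of the functions on `K` induced from the virtual characters of subgroups satisfying
`FixesTwo`. -/
def indSpan (p : ℕ) (H : Subgroup G) [Finite K] (j : K →* G) : AddSubgroup (K → ℂ) :=
  AddSubgroup.closure {χ | ∃ L : Subgroup K, FixesTwo p H (j.comp L.subtype) ∧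
    ∃ φ ∈ virtualChar L, indFun L φ = χ}

variable [Finite K] [Finite M]

theorem indFun_mem_indSpan {j : K →* G} {L : Subgroup K} (hL : FixesTwo p H (j.comp L.subtype))
    {φ : L → ℂ} (hφ : φ ∈ virtualChar L) : indFun L φ ∈ indSpan p H j :=
  AddSubgroup.subset_closure ⟨L, hL, φ, hφ, rfl⟩

theorem indHom_mem_indSpan {j : K →* G} {f : M →* K} (hf : Function.Injective f)
    (hj : FixesTwo p H (j.comp f)) {φ : M → ℂ} (hφ : φ ∈ virtualChar M) :
    indHom f φ ∈ indSpan p H j := by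
  rw [← indFun_range f hf]
  refine indFun_mem_indSpan ?_
    (virtualChar_comp (MonoidHom.ofInjective hf).symm.toMonoidHom hφ)
  have h : j.comp f.range.subtype =
      (j.comp f).comp (MonoidHom.ofInjective hf).symm.toMonoidHom := by
    ext x
    obtain ⟨k, rfl⟩ := (MonoidHom.ofInjective hf).surjective x
    have e : (((MonoidHom.ofInjective hf) k : f.range) : K) = f k := rfl
    simp [e]
  rw [h]
  exact hj.comp _

theorem indFun_mem_indSpan_of_mem {j : K →* G} {L : Subgroup K} {ψ : L → ℂ}
    (hψ : ψ ∈ indSpan p H (j.comp L.subtype)) : indFun L ψ ∈ indSpan p H j := by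
  have hle : indSpan p H (j.comp L.subtype) ≤ (indSpan p H j).comap (indFun L) := by
    refine (AddSubgroup.closure_le _).2 ?_
    rintro _ ⟨M, hM, φ, hφ, rfl⟩
    change indFun L (indFun M φ) ∈ indSpan p H j
    rw [indFun_eq_indHom L, indFun_eq_indHom M, indHom_comp]
    exact indHom_mem_indSpan (f := L.subtype.comp M.subtype)
      (fun x y h => Subtype.ext (Subtype.ext h)) hM hφ
  exact hle hψ

theorem indFun_mul_res {L : Subgroup K} (φ : L → ℂ) {χ : K → ℂ} (hχ : χ ∈ virtualChar K) :
    indFun L (φ * resFun L χ) = indFun L φ * χ := by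
  rw [indFun_eq_indHom, indFun_eq_indHom]
  exact indHom_mul L.subtype φ fun x g => virtualChar_conj hχ x g

theorem mul_mem_indSpan {j : K →* G} {b χ : K → ℂ} (hb : b ∈ indSpan p H j)
    (hχ : χ ∈ virtualChar K) : b * χ ∈ indSpan p H j := by
  have hle : indSpan p H j ≤ (indSpan p H j).comap (AddMonoidHom.mulRight χ) := by
    refine (AddSubgroup.closure_le _).2 ?_
    rintro _ ⟨L, hL, φ, hφ, rfl⟩
    change indFun L φ * χ ∈ indSpan p H j
    rw [← indFun_mul_res φ hχ]
    exact indFun_mem_indSpan hL (virtualChar_mul hφ (resFun_mem L hχ))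
  exact hle hb

/-- Applied below to cosets and to linear characters. The alternative of weight zero serves to
delete a base coset, an orbit or the trivial character from the sum. -/
theorem sum_fixed_mem_indSpan {X : Type*} [MulAction K X] [Fintype X] [DecidableEq X] {j : K →* G}
    (a : K → X → ℂ) (ha : ∀ h g x, g • x = x → a (h * g * h⁻¹) (h • x) = a g x)
    (hvc : ∀ x, (fun k : MulAction.stabilizer K x => a k x) ∈ virtualChar _)
    (hfix : ∀ x, (∀ g : K, g • x = x → a g x = 0) ∨
      FixesTwo p H (j.comp (MulAction.stabilizer K x).subtype)) :
    (fun g => ∑ x : X, if g • x = x then a g x else 0) ∈ indSpan p H j := by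
  refine sum_fixed_mem a ha _ fun x => ?_
  obtain h | h := hfix x
  · have : (fun k : MulAction.stabilizer K x => a k x) = 0 := funext fun k => h k k.2
    rw [this, map_zero]
    exact zero_mem _
  · exact indFun_mem_indSpan h (hvc x)

end FixesTwo

/-! ### Comparison of the subgroups `𝓘` with the intrinsic spans -/

theorem mem_indSpan_of_mem_inducedSubgroup {G K : Type*} [Group G] [Finite G] [Group K] [Finite K]
    {p : ℕ} [Fact p.Prime] (P : Sylow p G) {H : Subgroup G} (hPH : (P : Subgroup G) ≤ H)
    (j : K →* G) (P' : Subgroup K) {χ : virtualChar K}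
    (hχ : χ ∈ inducedSubgroup p P' {Q | Q.map j ∈ intersectionSet (P : Subgroup G) H}) :
    (χ : K → ℂ) ∈ indSpan p H j := by
  have hle : inducedSubgroup p P' {Q | Q.map j ∈ intersectionSet (P : Subgroup G) H} ≤
      (indSpan p H j).comap (virtualChar K).subtype := by
    refine (AddSubgroup.closure_le _).2 ?_
    rintro _ ⟨L, ⟨T, hT⟩, ⟨hQ, t, ht, hQt⟩, φ, rfl⟩
    -- The image of `L ∩ P'` lies in `P ≤ H`, so it fixes the base coset; it lies in `t P t⁻¹`, so
    -- it fixes `t H`.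
    refine indFun_mem_indSpan (fixesTwo_of_sylow _ T (y := ((1 : G) : G ⧸ H))
      (z := ((t : G) : G ⧸ H)) ?_ ?_) φ.2
    · rw [Ne, QuotientGroup.eq]
      simpa using ht
    · intro r hr
      have hr' : (r : K) ∈ P' := by
        have : r ∈ (T : Subgroup L) := hr
        rw [hT] at this
        exact Subgroup.mem_subgroupOf.1 this
      have hm : j r ∈ (L ⊓ P').map j := Subgroup.mem_map_of_mem j ⟨r.2, hr'⟩
      constructor
      · change ((j r * 1 : G) : G ⧸ H) = _
        rw [mul_one, eq_comm, QuotientGroup.eq]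
        simpa using hPH (hQ hm)
      · change ((j r * t : G) : G ⧸ H) = _
        obtain ⟨x, hx, hxr⟩ := hQt hm
        rw [eq_comm, QuotientGroup.eq, ← hxr]
        simpa [mul_assoc] using hPH hx
  exact hle hχ

/-- A conjugate of `L` has a Sylow `p`-subgroup inside `P'`, which by maximality is its intersection
with `P'`. Of the two cosets fixed by this subgroup, one is not the base coset and supplies the
element outside `H`. -/
theorem mem_inducedSubgroup_of_mem_indSpan {G K : Type*} [Group G] [Finite G] [Group K] [Finite K]
    {p : ℕ} [Fact p.Prime] (P : Sylow p G) {H : Subgroup G} (hPH : (P : Subgroup G) ≤ H)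
    (j : K →* G) (P' : Sylow p K)
    (hP' : (P' : Subgroup K).map j = P) {χ : virtualChar K}
    (hχ : (χ : K → ℂ) ∈ indSpan p H j) :
    χ ∈ inducedSubgroup p (P' : Subgroup K)
      {Q | Q.map j ∈ intersectionSet (P : Subgroup G) H} := by
  have hle : indSpan p H j ≤ (inducedSubgroup p (P' : Subgroup K)
      {Q | Q.map j ∈ intersectionSet (P : Subgroup G) H}).map (virtualChar K).subtype := by
    refine (AddSubgroup.closure_le _).2 ?_
    rintro _ ⟨L, hL, φ, hφ, rfl⟩
    obtain ⟨T₀⟩ : Nonempty (Sylow p L) := inferInstance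
    obtain ⟨k, hk⟩ := exists_conj_mem_sylow P' (T₀.2.map L.subtype)
    set f : L →* K := (MulAut.conj k⁻¹).toMonoidHom.comp L.subtype with hf
    have hfi : Function.Injective f := (MulAut.conj k⁻¹).injective.comp L.subtype_injective
    have hfT : ∀ r ∈ T₀, f r ∈ P' := by
      intro r hr
      simpa [hf] using hk r (Subgroup.mem_map_of_mem L.subtype hr)
    refine ⟨⟨indFun L φ, indFun_mem L hφ⟩, AddSubgroup.subset_closure ?_, rfl⟩
    have hsyl : ∃ T : Sylow p f.range, (T : Subgroup f.range) = (P' : Subgroup K).subgroupOf f.range ∧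
        ∀ x ∈ T, ∃ r ∈ T₀, f r = x := by
      let T := T₀.mapSurjective (f := f.rangeRestrict) f.rangeRestrict_surjective
      refine ⟨T, ?_, ?_⟩
      · refine (T.3 (P'.2.comap_of_injective f.range.subtype f.range.subtype_injective) ?_).symm
        rintro _ ⟨r, hr, rfl⟩
        exact hfT r hr
      · rintro _ ⟨r, hr, rfl⟩
        exact ⟨r, hr, rfl⟩
    obtain ⟨T, hT, hTr⟩ := hsyl
    refine ⟨f.range, ⟨T, hT⟩, ⟨?_, ?_⟩, ⟨_, virtualChar_comp
      (MonoidHom.ofInjective hfi).symm.toMonoidHom hφ⟩, ?_⟩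
    · rw [← hP']
      exact Subgroup.map_mono inf_le_right
    · have hRp : IsPGroup p ((f.range ⊓ (P' : Subgroup K)).map j) :=
        (P'.2.to_le inf_le_right).map j
      have hfix : ∃ t : G, t ∉ H ∧ ∀ x ∈ (f.range ⊓ (P' : Subgroup K)).map j, t⁻¹ * x * t ∈ H := by
        obtain ⟨y, z, hyz, h⟩ := (hL T₀ T₀.2)
        have hw : ∃ w : G ⧸ H, w ≠ ((1 : G) : G ⧸ H) ∧ ∀ r ∈ T₀, j (f r) • w = w := by
          have hc : ∀ y : G ⧸ H, (∀ r ∈ T₀, j r • y = y) →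
              ∀ r ∈ T₀, j (f r) • (j k)⁻¹ • y = (j k)⁻¹ • y := by
            intro y hy r hr
            simp [hf, mul_smul, hy r hr]
          by_cases hy1 : (j k)⁻¹ • y = ((1 : G) : G ⧸ H)
          · refine ⟨(j k)⁻¹ • z, fun hz1 => hyz ?_, hc z fun r hr => (h r hr).2⟩
            exact smul_left_cancel _ (hy1.trans hz1.symm)
          · exact ⟨(j k)⁻¹ • y, hy1, hc y fun r hr => (h r hr).1⟩
        obtain ⟨w, hw1, hw⟩ := hw
        obtain ⟨t, rfl⟩ := QuotientGroup.mk_surjective w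
        refine ⟨t, fun ht => hw1 ?_, ?_⟩
        · rw [QuotientGroup.eq]
          simpa using ht
        · rintro _ ⟨x, ⟨hx1, hx2⟩, rfl⟩
          obtain ⟨r, hr, hrx⟩ := hTr ⟨x, hx1⟩ (by
            change _ ∈ (T : Subgroup f.range)
            rw [hT]
            exact hx2)
          have := hw r hr
          rw [hrx] at this
          change ((j x * t : G) : G ⧸ H) = _ at this
          rw [eq_comm, QuotientGroup.eq] at this
          simpa [mul_assoc] using this
      obtain ⟨t, ht, hRt⟩ := hfix
      set R := (f.range ⊓ (P' : Subgroup K)).map j with hR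
      have hR' : IsPGroup p ((R.map (MulAut.conj t⁻¹).toMonoidHom).subgroupOf H) :=
        (hRp.map _).comap_of_injective H.subtype H.subtype_injective
      -- So far `t⁻¹ R t` is only a `p`-subgroup of `H`. Sylow's theorem in `H` moves it into `P`,
      -- and replacing `t` by `t h` with `h ∈ H` stays outside `H`.
      obtain ⟨h, hh⟩ := exists_conj_mem_sylow (P.subtype hPH) hR'
      refine ⟨t * h, fun hth => ht ?_, fun x hx => ?_⟩
      · simpa using H.mul_mem hth (H.inv_mem h.2)
      · have hxm := hh ⟨t⁻¹ * x * t, hRt x hx⟩ (by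
          rw [Subgroup.mem_subgroupOf]
          exact ⟨x, hx, by simp⟩)
        refine ⟨(h : G)⁻¹ * (t⁻¹ * x * t) * h, ?_, ?_⟩
        · exact hxm
        · simp [mul_assoc]
    · apply Subtype.ext
      change indFun f.range (fun x => φ ((MonoidHom.ofInjective hfi).symm x)) = indFun L φ
      rw [indFun_range f hfi, hf, indHom_conj_comp, indFun_eq_indHom]
  obtain ⟨χ', hχ', h⟩ := hle hχ
  exact (Subtype.ext h : χ' = χ) ▸ hχ'

/-! ### Induction as a sum over fixed cosets -/

open scoped Classical in
/-- Extension by zero of a function on a subgroup. -/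
noncomputable def extFun {G : Type*} [Group G] (L : Subgroup G) (φ : L → ℂ) (g : G) : ℂ :=
  if h : g ∈ L then φ ⟨g, h⟩ else 0

section quotient

variable {G : Type*} [Group G] {L : Subgroup G} {φ : L → ℂ}

theorem extFun_of_mem {g : G} (h : g ∈ L) : extFun L φ g = φ ⟨g, h⟩ := dif_pos h

theorem extFun_conj (hφ : φ ∈ virtualChar L) {l : G} (hl : l ∈ L) (g : G) :
    extFun L φ (l * g * l⁻¹) = extFun L φ g := by
  by_cases hg : g ∈ L
  · rw [extFun_of_mem hg, extFun_of_mem (L.mul_mem (L.mul_mem hl hg) (L.inv_mem hl))]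
    exact virtualChar_conj hφ ⟨l, hl⟩ ⟨g, hg⟩
  · have : l * g * l⁻¹ ∉ L := by
      rwa [L.mul_mem_cancel_right (L.inv_mem hl), L.mul_mem_cancel_left hl]
    rw [extFun, extFun, dif_neg hg, dif_neg this]

theorem out_conj_mem_iff (g : G) (z : G ⧸ L) : z.out⁻¹ * g * z.out ∈ L ↔ g • z = z := by
  conv_rhs => rw [← QuotientGroup.out_eq' z]
  rw [mul_assoc, ← QuotientGroup.eq, eq_comm]
  rfl

theorem extFun_out (hφ : φ ∈ virtualChar L) {x : G} {z : G ⧸ L} (hx : (x : G ⧸ L) = z) (g : G) :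
    extFun L φ (z.out⁻¹ * g * z.out) = extFun L φ (x⁻¹ * g * x) := by
  have hl : x⁻¹ * z.out ∈ L := by
    rw [← QuotientGroup.eq, hx, QuotientGroup.out_eq']
  rw [← extFun_conj hφ hl]
  congr 1
  group

theorem extFun_out_smul (hφ : φ ∈ virtualChar L) (h g : G) (z : G ⧸ L) :
    extFun L φ ((h • z).out⁻¹ * (h * g * h⁻¹) * (h • z).out) =
      extFun L φ (z.out⁻¹ * g * z.out) := by
  rw [extFun_out hφ (x := h * z.out)]
  · congr 1
    group
  · conv_rhs => rw [← QuotientGroup.out_eq' z]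
    rfl

-- The representative `z.out` is immaterial because `φ` is a class function on `L`.
open scoped Classical in
theorem indFun_eq_sum [Finite G] [Fintype (G ⧸ L)] (hφ : φ ∈ virtualChar L) (g : G) :
    indFun L φ g =
      ∑ z : G ⧸ L, if g • z = z then extFun L φ (z.out⁻¹ * g * z.out) else 0 := by
  have := Fintype.ofFinite G
  change (Nat.card L : ℂ)⁻¹ * ∑ᶠ y : G, extFun L φ (y * g * y⁻¹) = _
  rw [finsum_eq_sum_of_fintype, inv_mul_eq_iff_eq_mul₀ (by exact_mod_cast Nat.card_pos.ne')]
  have hsum := sum_smul_eq (L := G) ((1 : G) : G ⧸ L)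
    (fun z => if g • z = z then extFun L φ (z.out⁻¹ * g * z.out) else 0)
  have horb : ∀ z : G ⧸ L, z ∈ MulAction.orbit G ((1 : G) : G ⧸ L) :=
    fun z => MulAction.exists_smul_eq G _ z
  simp only [horb, Finset.filter_true] at hsum
  rw [MulAction.stabilizer_quotient] at hsum
  rw [← hsum]
  refine Fintype.sum_equiv (Equiv.inv G) _ _ fun y => ?_
  have hy : (((Equiv.inv G) y : G) : G ⧸ L) = (Equiv.inv G) y • ((1 : G) : G ⧸ L) := by
    change _ = (((Equiv.inv G) y * 1 : G) : G ⧸ L)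
    rw [mul_one]
  rw [← hy, extFun_out hφ rfl]
  split_ifs with h
  · simp
  · rw [← out_conj_mem_iff] at h
    have h2 : (y⁻¹)⁻¹ * g * y⁻¹ ∉ L := by
      intro h3
      apply h
      rw [out_conj_mem_iff]
      change ((g * y⁻¹ : G) : G ⧸ L) = (y⁻¹ : G)
      rw [eq_comm, QuotientGroup.eq]
      simpa [mul_assoc] using h3
    rw [inv_inv] at h2
    exact dif_neg h2

/-- Conjugation by the chosen representative of a coset maps its stabilizer into the subgroup. -/
noncomputable def stabilizerHom (H : Subgroup G) (z : G ⧸ L) : MulAction.stabilizer H z →* L where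
  toFun k := ⟨z.out⁻¹ * (k : G) * z.out, (out_conj_mem_iff _ z).2 k.2⟩
  map_one' := by simp
  map_mul' x y := by
    apply Subtype.ext
    simp [mul_assoc]

theorem extFun_stabilizer [Finite G] (hφ : φ ∈ virtualChar L) (H : Subgroup G) (z : G ⧸ L) :
    (fun k : MulAction.stabilizer H z => extFun L φ (z.out⁻¹ * ((k : H) : G) * z.out)) ∈
      virtualChar (MulAction.stabilizer H z) := by
  have h : (fun k : MulAction.stabilizer H z => extFun L φ (z.out⁻¹ * ((k : H) : G) * z.out)) =
      fun k => φ (stabilizerHom H z k) :=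
    funext fun k => extFun_of_mem ((out_conj_mem_iff _ z).2 k.2)
  rw [h]
  exact virtualChar_comp _ hφ

/-- The stabilizer of `x L` in `H` is `H ∩ x L x⁻¹`, which is conjugate to a subgroup of `L`. -/
theorem FixesTwo.stabilizer {p : ℕ} {M : Subgroup G} (hL : FixesTwo p M L.subtype)
    (H : Subgroup G) (z : G ⧸ L) :
    FixesTwo p M (H.subtype.comp (MulAction.stabilizer H z).subtype) := by
  have h : H.subtype.comp (MulAction.stabilizer H z).subtype =
      (MulAut.conj z.out).toMonoidHom.comp (L.subtype.comp (stabilizerHom H z)) := by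
    ext k
    simp [stabilizerHom, mul_assoc]
  rw [h]
  exact (hL.comp _).conj _

end quotient

/-! ### Mackey decomposition of restrictions to `H` -/

section main

variable {G : Type*} [Group G] [Finite G] {p : ℕ} {H : Subgroup G}

theorem resFun_mem_indSpan {χ : G → ℂ} (hχ : χ ∈ indSpan p H (MonoidHom.id G)) :
    resFun H χ ∈ indSpan p H H.subtype := by
  classical
  have hle : indSpan p H (MonoidHom.id G) ≤ (indSpan p H H.subtype).comap (resFun H) := by
    refine (AddSubgroup.closure_le _).2 ?_
    rintro _ ⟨L, hL, φ, hφ, rfl⟩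
    have := Fintype.ofFinite (G ⧸ L)
    have h : resFun H (indFun L φ) = fun h : H => ∑ z : G ⧸ L,
        if h • z = z then extFun L φ (z.out⁻¹ * (h : G) * z.out) else 0 :=
      funext fun h => indFun_eq_sum hφ h
    change resFun H (indFun L φ) ∈ indSpan p H H.subtype
    rw [h]
    exact sum_fixed_mem_indSpan (fun (h : H) (z : G ⧸ L) => extFun L φ (z.out⁻¹ * (h : G) * z.out))
      (fun h g z _ => extFun_out_smul hφ h g z) (extFun_stabilizer hφ H)
      fun z => Or.inr (FixesTwo.stabilizer hL H z)
  exact hle hχ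

/-- The base coset contributes `φ` itself. The stabilizer in `H` of any other coset fixes both that
coset and the base coset. -/
theorem resFun_indFun_sub_mem {φ : H → ℂ} (hφ : φ ∈ virtualChar H) :
    resFun H (indFun H φ) - φ ∈ indSpan p H H.subtype := by
  classical
  have := Fintype.ofFinite (G ⧸ H)
  have hH : ∀ h : H, h • ((1 : G) : G ⧸ H) = ((1 : G) : G ⧸ H) := by
    intro h
    change ((h * 1 : G) : G ⧸ H) = _
    rw [mul_one, eq_comm, QuotientGroup.eq]
    simp
  have e : resFun H (indFun H φ) - φ = fun h : H => ∑ z : G ⧸ H, if h • z = z then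
      (if z = ((1 : G) : G ⧸ H) then 0 else extFun H φ (z.out⁻¹ * (h : G) * z.out)) else 0 := by
    funext h
    rw [Pi.sub_apply, sub_eq_iff_eq_add]
    change indFun H φ h = _
    rw [indFun_eq_sum hφ, ← Finset.add_sum_erase _ _ (Finset.mem_univ ((1 : G) : G ⧸ H)),
      ← Finset.add_sum_erase (a := ((1 : G) : G ⧸ H)) (f := fun z => if h • z = z then
        (if z = ((1 : G) : G ⧸ H) then 0 else extFun H φ (z.out⁻¹ * (h : G) * z.out)) else 0)
        _ (Finset.mem_univ ((1 : G) : G ⧸ H))]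
    have h1 : (h : G) • ((1 : G) : G ⧸ H) = ((1 : G) : G ⧸ H) := hH h
    rw [if_pos h1, extFun_out hφ rfl, if_pos (hH h), if_pos rfl, zero_add, add_comm]
    congr 1
    · refine Finset.sum_congr rfl fun z hz => ?_
      rw [if_neg (Finset.ne_of_mem_erase hz)]
      rfl
    · rw [inv_one, one_mul, mul_one, extFun_of_mem h.2]
  rw [e]
  refine sum_fixed_mem_indSpan (fun (h : H) (z : G ⧸ H) =>
    if z = ((1 : G) : G ⧸ H) then 0 else extFun H φ (z.out⁻¹ * (h : G) * z.out)) ?_ ?_ ?_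
  · intro h g z _
    have : h • z = ((1 : G) : G ⧸ H) ↔ z = ((1 : G) : G ⧸ H) := by
      conv_lhs => rw [← hH h]
      exact smul_left_cancel_iff h
    simp only [this]
    split_ifs
    · rfl
    · exact extFun_out_smul hφ h g z
  · intro z
    by_cases hz : z = ((1 : G) : G ⧸ H)
    · simp only [hz, if_true]
      exact zero_mem (virtualChar (MulAction.stabilizer H z))
    · simp only [hz, if_false]
      exact extFun_stabilizer hφ H z
  · intro z
    by_cases hz : z = ((1 : G) : G ⧸ H)
    · exact Or.inl fun g _ => if_pos hz
    · exact Or.inr (fixesTwo_of_fixed _ hz (fun k => k.2) fun k => hH k)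

end main

/-! ### Isotypic parts over a normal abelian subgroup -/

section isotypic

variable {K : Type*} [Group K]

/-- The conjugation action on the linear characters of a normal subgroup. -/
instance linearCharAction (C : Subgroup K) [C.Normal] : MulAction K (C →* ℂˣ) where
  smul g l := l.comp (MulAut.conjNormal g⁻¹).toMonoidHom
  one_smul l := by
    change l.comp (MulAut.conjNormal (1 : K)⁻¹).toMonoidHom = l
    ext c
    simp
  mul_smul g h l := by
    change l.comp (MulAut.conjNormal (g * h)⁻¹).toMonoidHom =
      (l.comp (MulAut.conjNormal h⁻¹).toMonoidHom).comp (MulAut.conjNormal g⁻¹).toMonoidHom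
    ext c
    simp

theorem linearChar_smul_apply {C : Subgroup K} [C.Normal] (g : K) (l : C →* ℂˣ) (c : C) :
    (g • l) c = l (MulAut.conjNormal g⁻¹ c) := rfl

/-- The trace of `g` on the `l`-isotypic part, in terms of the character `π`. -/
noncomputable def isotypicPart {C : Subgroup K} (π : K → ℂ) (l : C →* ℂˣ) (g : K) : ℂ :=
  (Nat.card C : ℂ)⁻¹ * ∑ᶠ c : C, ((l c)⁻¹ : ℂˣ) * π (g * c)

variable [Finite K] {C : Subgroup K}

open scoped IsMulCommutative in
theorem sum_linearChar [IsMulCommutative C] [Fintype (C →* ℂˣ)] (c : C) [Decidable (c = 1)] :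
    ∑ l : C →* ℂˣ, ((l c : ℂˣ) : ℂ) = if c = 1 then (Nat.card C : ℂ) else 0 := by
  classical
  let ev : (C →* ℂˣ) →* ℂ := (Units.coeHom ℂ).comp (MonoidHom.eval c)
  have h := sum_hom_units ev
  have hev : ev = 1 ↔ c = 1 := by
    constructor
    · intro h1
      by_contra hc
      obtain ⟨φ, hφ⟩ := CommGroup.exists_apply_ne_one_of_hasEnoughRootsOfUnity C ℂ hc
      exact hφ (Units.ext (DFunLike.congr_fun h1 φ))
    · rintro rfl
      ext φ
      simp [ev]
  simp only [hev, ← Nat.card_eq_fintype_card] at h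
  rw [CommGroup.card_monoidHom_of_hasEnoughRootsOfUnity C ℂ] at h
  exact_mod_cast h

theorem sum_isotypicPart [IsMulCommutative C] [Fintype (C →* ℂˣ)] (π : K → ℂ) (g : K) :
    ∑ l : C →* ℂˣ, isotypicPart π l g = π g := by
  classical
  have := Fintype.ofFinite C
  simp only [isotypicPart, finsum_eq_sum_of_fintype]
  rw [← Finset.mul_sum, Finset.sum_comm]
  have : ∀ c : C, ∑ l : C →* ℂˣ, (((l c)⁻¹ : ℂˣ) : ℂ) * π (g * c) =
      if c = 1 then (Nat.card C : ℂ) * π g else 0 := by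
    intro c
    rw [← Finset.sum_mul]
    simp only [← map_inv]
    rw [sum_linearChar]
    simp only [inv_eq_one]
    split_ifs with h
    · simp [h]
    · simp
  simp only [this, Finset.sum_ite_eq', Finset.mem_univ, if_true]
  rw [inv_mul_cancel_left₀]
  exact_mod_cast Nat.card_pos.ne'

theorem isotypicPart_smul [C.Normal] {π : K → ℂ} (hπ : ∀ x g, π (x * g * x⁻¹) = π g)
    (h g : K) (l : C →* ℂˣ) : isotypicPart π (h • l) (h * g * h⁻¹) = isotypicPart π l g := by
  have := Fintype.ofFinite C
  simp only [isotypicPart, finsum_eq_sum_of_fintype]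
  congr 1
  refine Fintype.sum_equiv (MulAut.conjNormal h⁻¹ : MulAut C).toEquiv _ _ fun c => ?_
  rw [linearChar_smul_apply]
  congr 1
  refine Eq.trans ?_ (hπ h _)
  congr 1
  simp [mul_assoc]

theorem isotypicPart_mul_right (π : K → ℂ) (l : C →* ℂˣ) (g : K) (d : C) :
    isotypicPart π l (g * d) = l d * isotypicPart π l g := by
  have := Fintype.ofFinite C
  simp only [isotypicPart, finsum_eq_sum_of_fintype]
  conv_rhs => rw [mul_left_comm, Finset.mul_sum]
  congr 1
  refine Fintype.sum_equiv (Equiv.mulLeft d) _ _ fun c => ?_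
  rw [← mul_assoc, ← Units.val_mul]
  simp [mul_assoc]

theorem isotypicPart_eq_zero_of_apply_ne_one {π : K → ℂ} {l : C →* ℂˣ} {d : C} (hd : l d ≠ 1)
    (h : ∀ g, isotypicPart π l (g * d) = isotypicPart π l g) (g : K) :
    isotypicPart π l g = 0 := by
  have h1 := h g
  rw [isotypicPart_mul_right] at h1
  by_contra h0
  exact hd (Units.ext (mul_right_cancel₀ h0 (h1.trans (one_mul _).symm)))

-- Choose `d ∈ C` with `l (g⁻¹ d g) ≠ l d`. Conjugation by `d` fixes `l`, hence preserves the value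
-- at `g`; but `d g d⁻¹ = g (g⁻¹ d g d⁻¹)`, so it also multiplies this value by a number other than
-- `1`.
open scoped IsMulCommutative in
theorem isotypicPart_eq_zero [IsMulCommutative C] [C.Normal] {π : K → ℂ}
    (hπ : ∀ x g, π (x * g * x⁻¹) = π g) {g : K} {l : C →* ℂˣ} (hg : g • l ≠ l) :
    isotypicPart π l g = 0 := by
  obtain ⟨d, hd⟩ : ∃ d, (g • l) d ≠ l d := by
    by_contra! h
    exact hg (MonoidHom.ext h)
  rw [linearChar_smul_apply] at hd
  have hdl : ∀ c : C, c • l = l := by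
    intro c
    ext e
    change ((l (MulAut.conjNormal (c : K)⁻¹ e) : ℂˣ) : ℂ) = l e
    congr 2
    apply Subtype.ext
    have := congrArg Subtype.val (mul_comm e c)
    simp only [Subgroup.coe_mul] at this
    simp [mul_assoc, this]
  have h1 := isotypicPart_smul hπ (d : K) g l
  have hdl' : (d : K) • l = l := hdl d
  rw [hdl'] at h1
  have h2 : (d : K) * g * (d : K)⁻¹ = g * ((MulAut.conjNormal g⁻¹ d * d⁻¹ : C) : K) := by
    simp [mul_assoc]
  rw [h2, isotypicPart_mul_right] at h1
  by_contra h0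
  have h3 : l (MulAut.conjNormal g⁻¹ d * d⁻¹) = 1 :=
    Units.ext (mul_right_cancel₀ h0 (h1.trans (one_mul _).symm))
  rw [map_mul, map_inv l, mul_inv_eq_one] at h3
  exact hd h3

/-- The average `e` of the `(l c)⁻¹ ρ c` projects `V` onto the `l`-eigenspace `W` of `C`, which the
stabilizer of `l` preserves; the trace of `ρ g ∘ e` is the trace of `g` on `W`. -/
theorem isotypicPart_character_mem [C.Normal] {V : Type*} [AddCommGroup V] [Module ℂ V]
    [FiniteDimensional ℂ V] (ρ : Representation ℂ K V) (l : C →* ℂˣ) :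
    (fun g : MulAction.stabilizer K l => isotypicPart ρ.character l g) ∈
      virtualChar (MulAction.stabilizer K l) := by
  have := Fintype.ofFinite C
  let W : Submodule ℂ V :=
    { carrier := {v | ∀ c : C, ρ c v = (l c : ℂ) • v}
      add_mem' := fun {v w} hv hw c => by rw [map_add, hv, hw, smul_add]
      zero_mem' := fun c => by simp
      smul_mem' := fun a v hv c => by rw [map_smul, hv, smul_comm] }
  have hW : ∀ (g : MulAction.stabilizer K l), ∀ v ∈ W, ρ g v ∈ W := by
    intro g v hv c
    have h1 : (c : K) * g = g * (MulAut.conjNormal (g : K)⁻¹ c : C) := by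
      simp [mul_assoc]
    have h2 : l (MulAut.conjNormal (g : K)⁻¹ c) = l c := DFunLike.congr_fun g.2 c
    rw [← Module.End.mul_apply, ← map_mul, h1, map_mul, Module.End.mul_apply, hv, map_smul, h2]
  let σ : Representation ℂ (MulAction.stabilizer K l) W :=
    { toFun := fun g => (ρ g).restrict (hW g)
      map_one' := by
        ext v
        simp [LinearMap.restrict_apply]
      map_mul' := fun g h => by
        ext v
        simp [LinearMap.restrict_apply] }
  let e : V →ₗ[ℂ] V := (Nat.card C : ℂ)⁻¹ • ∑ c : C, (((l c)⁻¹ : ℂˣ) : ℂ) • ρ c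
  have he : ∀ v, e v = (Nat.card C : ℂ)⁻¹ • ∑ c : C, (((l c)⁻¹ : ℂˣ) : ℂ) • ρ c v := by
    intro v
    simp [e]
  have heW : ∀ v, e v ∈ W := by
    intro v d
    rw [he, map_smul, map_sum]
    conv_rhs => rw [smul_comm, Finset.smul_sum]
    congr 1
    refine Fintype.sum_equiv (Equiv.mulLeft d) _ _ fun c => ?_
    rw [map_smul, ← Module.End.mul_apply, ← map_mul, smul_smul, ← Units.val_mul]
    simp
  have heq : ∀ v ∈ W, e v = v := by
    intro v hv
    rw [he]
    have : ∀ c : C, (((l c)⁻¹ : ℂˣ) : ℂ) • ρ c v = v := by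
      intro c
      rw [hv c, smul_smul, ← Units.val_mul]
      simp
    simp only [this, Finset.sum_const, Finset.card_univ, ← Nat.card_eq_fintype_card]
    rw [← Nat.cast_smul_eq_nsmul ℂ, smul_smul, inv_mul_cancel₀, one_smul]
    exact_mod_cast Nat.card_pos.ne'
  have h : (fun g : MulAction.stabilizer K l => isotypicPart ρ.character l g) = σ.character := by
    funext g
    have hf : ∀ v, (ρ g ∘ₗ e) v ∈ W := fun v => hW g _ (heW v)
    have h1 : σ.character g = LinearMap.trace ℂ V (ρ g ∘ₗ e) := by
      rw [← LinearMap.trace_restrict_eq_of_forall_mem W _ hf]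
      unfold Representation.character
      congr 1
      ext v
      change ρ g v = ρ g (e v)
      rw [heq v v.2]
    rw [h1]
    simp only [isotypicPart, finsum_eq_sum_of_fintype, e, LinearMap.comp_smul, map_smul,
      smul_eq_mul]
    congr 1
    have h2 : ρ g ∘ₗ (∑ c : C, (((l c)⁻¹ : ℂˣ) : ℂ) • ρ c) =
        ∑ c : C, (((l c)⁻¹ : ℂˣ) : ℂ) • ρ (g * c) := by
      ext v
      simp
    rw [h2, map_sum]
    refine Finset.sum_congr rfl fun c _ => ?_
    rw [map_smul, smul_eq_mul]
    rfl
  rw [h]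
  exact character_mem σ

theorem isotypicPart_mem [C.Normal] {π : K → ℂ} (hπ : π ∈ virtualChar K) (l : C →* ℂˣ) :
    (fun g : MulAction.stabilizer K l => isotypicPart π l g) ∈
      virtualChar (MulAction.stabilizer K l) := by
  have := Fintype.ofFinite C
  induction hπ using AddSubgroup.closure_induction with
  | mem χ h =>
    obtain ⟨V, _, _, _, ρ, -, rfl⟩ := h
    exact isotypicPart_character_mem ρ l
  | zero =>
    have : (fun g : MulAction.stabilizer K l => isotypicPart 0 l g) = 0 := by
      funext g
      simp [isotypicPart]
    rw [this]
    exact zero_mem _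
  | add χ ψ _ _ h1 h2 =>
    have : (fun g : MulAction.stabilizer K l => isotypicPart (χ + ψ) l g) =
        (fun g : MulAction.stabilizer K l => isotypicPart χ l g) +
        (fun g : MulAction.stabilizer K l => isotypicPart ψ l g) := by
      funext g
      simp [isotypicPart, finsum_eq_sum_of_fintype, mul_add, Finset.sum_add_distrib]
    rw [this]
    exact add_mem h1 h2
  | neg χ _ h =>
    have : (fun g : MulAction.stabilizer K l => isotypicPart (-χ) l g) =
        -(fun g : MulAction.stabilizer K l => isotypicPart χ l g) := by
      funext g
      simp [isotypicPart, finsum_eq_sum_of_fintype]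
    rw [this]
    exact neg_mem h

/-- Clifford theory: the `l`-part vanishes at `g` unless `g` fixes `l`, so `π` is a sum over fixed
points of `K` on the linear characters of `C`, and subtracting `1` removes `l = 1`. -/
theorem sub_one_mem_indSpan {G : Type*} [Group G] {p : ℕ} {H : Subgroup G} {j : K →* G}
    [IsMulCommutative C] [C.Normal] {π : K → ℂ} (hπ : π ∈ virtualChar K)
    (h1 : ∀ g, isotypicPart π (1 : C →* ℂˣ) g = 1)
    (h : ∀ l : C →* ℂˣ, l ≠ 1 → (∀ g, isotypicPart π l g = 0) ∨
      FixesTwo p H (j.comp (MulAction.stabilizer K l).subtype)) :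
    π - 1 ∈ indSpan p H j := by
  classical
  have := Fintype.ofFinite (C →* ℂˣ)
  have hone : ∀ g : K, g • (1 : C →* ℂˣ) = 1 := fun g => rfl
  have hc := fun x g => virtualChar_conj hπ x g
  have e : π - 1 = fun g => ∑ l : C →* ℂˣ,
      if g • l = l then (if l = 1 then 0 else isotypicPart π l g) else 0 := by
    funext g
    rw [Pi.sub_apply, ← sum_isotypicPart (C := C) π g,
      ← Finset.add_sum_erase _ _ (Finset.mem_univ (1 : C →* ℂˣ)),
      ← Finset.add_sum_erase (f := fun l : C →* ℂˣ =>
        if g • l = l then (if l = 1 then 0 else isotypicPart π l g) else 0) _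
        (Finset.mem_univ (1 : C →* ℂˣ)), h1]
    simp only [hone, if_true, zero_add, Pi.one_apply, add_sub_cancel_left]
    refine Finset.sum_congr rfl fun l hl => ?_
    rw [if_neg (Finset.ne_of_mem_erase hl)]
    split_ifs with hgl
    · rfl
    · exact isotypicPart_eq_zero hc hgl
  rw [e]
  refine sum_fixed_mem_indSpan (fun g l => if l = 1 then 0 else isotypicPart π l g) ?_ ?_ ?_
  · intro k g l _
    have : k • l = 1 ↔ l = 1 := by
      conv_lhs => rw [← hone k]
      exact smul_left_cancel_iff k
    simp only [this, isotypicPart_smul hc]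
  · intro l
    by_cases hl : l = 1
    · simp only [hl, if_true]
      exact zero_mem (virtualChar (MulAction.stabilizer K l))
    · simp only [hl, if_false]
      exact isotypicPart_mem hπ l
  · intro l
    by_cases hl : l = 1
    · exact Or.inl fun _ _ => if_pos hl
    · refine (h l hl).imp (fun h0 g _ => ?_) id
      rw [if_neg hl, h0 g]

end isotypic

/-! ### The permutation character on the cosets, restricted to hyperelementary subgroups -/

theorem mem_of_pow_mem_of_coprime {K : Type*} [Group K] {C : Subgroup K} {x : K} {n : ℕ}
    (hn : n.Coprime (orderOf x)) (h : x ^ n ∈ C) : x ∈ C := by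
  obtain ⟨m, hm⟩ := exists_pow_eq_self_of_coprime hn
  exact hm ▸ C.pow_mem h m

theorem mem_indSpan_of_fixesTwo {G K : Type*} [Group G] [Group K] [Finite K] {p : ℕ}
    {H : Subgroup G} {j : K →* G} (hj : FixesTwo p H j) {φ : K → ℂ} (hφ : φ ∈ virtualChar K) :
    φ ∈ indSpan p H j := by
  classical
  have := Fintype.ofFinite K
  have h : indHom (MonoidHom.id K) φ = φ := by
    funext g
    simp only [indHom, finsum_eq_sum_of_fintype, MonoidHom.id_apply, Finset.sum_ite_eq',
      Finset.mem_univ, if_true, virtualChar_conj hφ, Finset.sum_const, Finset.card_univ,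
      ← Nat.card_eq_fintype_card, nsmul_eq_mul]
    rw [inv_mul_cancel_left₀]
    exact_mod_cast Nat.card_pos.ne'
  rw [← h]
  exact indHom_mem_indSpan (f := MonoidHom.id K) Function.injective_id hj hφ

theorem smul_mem_orbit_iff {K X : Type*} [Group K] [MulAction K X] {g : K} {x y : X} :
    g • x ∈ MulAction.orbit K y ↔ x ∈ MulAction.orbit K y := by
  rw [← MulAction.orbit_eq_iff, ← MulAction.orbit_eq_iff, MulAction.orbit_smul]

theorem constant_mem {K : Type*} [Group K] [Finite K] (P : Prop) [Decidable P] :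
    (fun _ : K => if P then (1 : ℂ) else 0) ∈ virtualChar K := by
  split_ifs
  · exact virtualChar_one
  · exact zero_mem (virtualChar K)

section

variable {G : Type*} [Group G] [Finite G] {p : ℕ} [Fact p.Prime] {H L : Subgroup G}

-- Suppose a `p`-subgroup `R` stabilizing `l` fixes only one coset. Elements of `C` centralized by
-- `R` fix that coset, so `l` is trivial on them. The product of the `R`-conjugates of `c ∈ C` is
-- such an element, and `l` takes the value `(l c) ^ |R|` there; since `|R|` is prime to `|C|`, `l c
-- = 1`.
open scoped IsMulCommutative in
theorem fixesTwo_stabilizer_linearChar {C : Subgroup L} [C.Normal] [IsMulCommutative C]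
    (hcop : (Nat.card C).Coprime p) {x₀ : G ⧸ H} (T : Sylow p L) (hT : ∀ t ∈ T, t • x₀ = x₀)
    (hC : ∀ l : L, ∃ c : C, l • x₀ = c • x₀) {l : C →* ℂˣ} (hl : l ≠ 1)
    (hker : ∀ c : C, c • x₀ = x₀ → l c = 1) :
    FixesTwo p H (L.subtype.comp (MulAction.stabilizer L l).subtype) := by
  intro R hR
  have := Fintype.ofFinite R
  obtain ⟨k, hk⟩ := exists_conj_mem_sylow T (hR.map (MulAction.stabilizer L l).subtype)
  have hx : ∀ r ∈ R, (r : L) • k • x₀ = k • x₀ := by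
    intro r hr
    have := hT _ (hk r (Subgroup.mem_map_of_mem _ hr))
    simpa [mul_smul, inv_smul_eq_iff] using this
  by_contra hcon
  have huniq : ∀ z : G ⧸ H, (∀ r ∈ R, (r : L) • z = z) → z = k • x₀ := by
    intro z hz
    by_contra hne
    exact hcon ⟨z, k • x₀, hne, fun r hr => ⟨hz r hr, hx r hr⟩⟩
  have hcent : ∀ c : C, (∀ r : R, MulAut.conjNormal ((r : MulAction.stabilizer L l) : L) c = c) →
      l c = 1 := by
    intro c hc
    apply hker
    have h1 : c • k • x₀ = k • x₀ := by
      apply huniq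
      intro r hr
      have h2 : (r : L) * c = c * r := by
        have := congrArg Subtype.val (hc ⟨r, hr⟩)
        rw [MulAut.conjNormal_apply] at this
        exact mul_inv_eq_iff_eq_mul.1 this
      change (r : L) • (c : L) • k • x₀ = (c : L) • k • x₀
      rw [← mul_smul, h2, mul_smul, hx r hr]
    -- The fixed coset is `d • x₀` with `d ∈ C`; as `C` is abelian, an element of `C` fixing it also
    -- fixes `x₀`.
    obtain ⟨d, hd⟩ := hC k
    rw [hd, ← mul_smul, mul_comm, mul_smul] at h1
    exact smul_left_cancel d h1
  apply hl
  ext c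
  have hn : ∀ s : R, MulAut.conjNormal ((s : MulAction.stabilizer L l) : L)
      (∏ r : R, MulAut.conjNormal ((r : MulAction.stabilizer L l) : L) c) =
      ∏ r : R, MulAut.conjNormal ((r : MulAction.stabilizer L l) : L) c := by
    intro s
    rw [map_prod]
    refine Fintype.prod_equiv (Equiv.mulLeft s) _ _ fun r => ?_
    rw [← MulAut.mul_apply, ← map_mul]
    rfl
  have h1 := hcent _ hn
  have hinv : ∀ r : R, l (MulAut.conjNormal ((r : MulAction.stabilizer L l) : L) c) = l c := by
    intro r
    have := DFunLike.congr_fun (r⁻¹ : MulAction.stabilizer L l).2 c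
    rw [linearChar_smul_apply] at this
    simpa using this
  rw [map_prod] at h1
  simp only [hinv, Finset.prod_const, Finset.card_univ, ← Nat.card_eq_fintype_card] at h1
  obtain ⟨n, hn⟩ := IsPGroup.iff_card.1 hR
  have h2 : l c ^ Nat.card C = 1 := by
    rw [← map_pow, pow_card_eq_one', map_one]
  have h3 : orderOf (l c) ∣ Nat.gcd (Nat.card R) (Nat.card C) :=
    Nat.dvd_gcd (orderOf_dvd_of_pow_eq_one h1) (orderOf_dvd_of_pow_eq_one h2)
  rw [hn, Nat.Coprime.gcd_eq_one (hcop.symm.pow_left n), Nat.dvd_one, orderOf_eq_one_iff] at h3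
  rw [h3]
  rfl

open scoped Classical in
/-- The permutation character of `L` on the orbit of a coset. -/
noncomputable def orbitChar (L : Subgroup G) (x₀ : G ⧸ H) [Fintype (G ⧸ H)] (g : L) : ℂ :=
  ∑ x : G ⧸ H, if g • x = x then (if x ∈ MulAction.orbit L x₀ then 1 else 0) else 0

variable [Fintype (G ⧸ H)]

theorem orbitChar_mem (L : Subgroup G) (x₀ : G ⧸ H) : orbitChar L x₀ ∈ virtualChar L := by
  classical
  refine sum_fixed_mem (fun (_ : L) x => if x ∈ MulAction.orbit L x₀ then (1 : ℂ) else 0) ?_ _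
    fun x => indFun_mem _ (constant_mem _)
  intro h g x _
  simp only [smul_mem_orbit_iff]

-- Since `C` is transitive on the orbit, elements of a coset `g C` have one fixed point there on
-- average, so the trivial part is `1`. Since `C` is abelian, its stabilizer of `x₀` acts trivially
-- on the orbit, which kills every `l` that is nontrivial on this stabilizer.
open scoped IsMulCommutative in
theorem orbitChar_sub_one_mem {C : Subgroup L} [C.Normal] [IsMulCommutative C]
    (hcop : (Nat.card C).Coprime p) {x₀ : G ⧸ H} (T : Sylow p L) (hT : ∀ t ∈ T, t • x₀ = x₀)
    (hC : ∀ l : L, ∃ c : C, l • x₀ = c • x₀) :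
    orbitChar L x₀ - 1 ∈ indSpan p H L.subtype := by
  classical
  have := Fintype.ofFinite C
  refine sub_one_mem_indSpan (C := C) (orbitChar_mem L x₀) ?_ ?_
  · intro g
    have horb : ∀ x ∈ MulAction.orbit L x₀, ∀ y,
        y ∈ MulAction.orbit C x ↔ y ∈ MulAction.orbit L x₀ := by
      rintro _ ⟨l, rfl⟩ y
      obtain ⟨c, hc⟩ := hC l
      constructor
      · rintro ⟨d, rfl⟩
        exact ⟨d * l, mul_smul _ _ _⟩
      · rintro ⟨m, rfl⟩
        obtain ⟨d, hd⟩ := hC m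
        refine ⟨d * c⁻¹, ?_⟩
        change (d * c⁻¹) • l • x₀ = m • x₀
        rw [hc, hd, mul_smul, inv_smul_smul]
    set n : ℂ := ∑ z : G ⧸ H with z ∈ MulAction.orbit L x₀, 1 with hn
    have hn0 : n ≠ 0 := by
      rw [hn, Finset.sum_const, nsmul_eq_mul, mul_one, Nat.cast_ne_zero]
      exact (Finset.card_pos.2 ⟨x₀, by simp⟩).ne'
    have hst : ∀ x ∈ MulAction.orbit L x₀,
        (Nat.card (MulAction.stabilizer C x) : ℂ) = Nat.card C / n := by
      intro x hx
      have := sum_smul_eq (L := C) x fun _ => (1 : ℂ)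
      simp only [horb x hx] at this
      rw [eq_div_iff hn0, ← this]
      simp
    -- The `c` counted here are those carrying `x` to `g⁻¹ • x`; they form a coset of the stabilizer
    -- of `x` in `C`.
    have hsum : ∀ x ∈ MulAction.orbit L x₀,
        ∑ c : C, (if (g * c : L) • x = x then (1 : ℂ) else 0) = Nat.card C / n := by
      intro x hx
      have := sum_smul_eq (L := C) x fun z => if g • z = x then (1 : ℂ) else 0
      simp only [horb x hx] at this
      simp only [mul_smul]
      refine this.trans ?_
      rw [hst x hx, Finset.sum_eq_single (g⁻¹ • x)]
      · simp
      · intro z _ hz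
        rw [if_neg]
        rintro rfl
        simp at hz
      · intro h
        exact absurd (by simpa [smul_mem_orbit_iff] using hx) h
    simp only [isotypicPart, finsum_eq_sum_of_fintype, MonoidHom.one_apply, inv_one,
      Units.val_one, one_mul, orbitChar]
    rw [Finset.sum_comm, inv_mul_eq_iff_eq_mul₀ (by exact_mod_cast Nat.card_pos.ne'), mul_one]
    have h2 : ∀ x : G ⧸ H, ∑ c : C, (if (g * c : L) • x = x then
        (if x ∈ MulAction.orbit L x₀ then (1 : ℂ) else 0) else 0) =
        if x ∈ MulAction.orbit L x₀ then (Nat.card C / n) * 1 else 0 := by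
      intro x
      split_ifs with hx
      · rw [mul_one]
        exact hsum x hx
      · simp
    simp only [h2]
    rw [← Finset.sum_filter, ← Finset.mul_sum, ← hn, div_mul_cancel₀ _ hn0]
  · intro l hl
    by_cases hker : ∀ c : C, c • x₀ = x₀ → l c = 1
    · exact Or.inr (fixesTwo_stabilizer_linearChar hcop T hT hC hl hker)
    · left
      push Not at hker
      obtain ⟨d, hd, hld⟩ := hker
      have hdx : ∀ x ∈ MulAction.orbit L x₀, (d : L) • x = x := by
        rintro _ ⟨m, rfl⟩
        obtain ⟨c, hc⟩ := hC m
        change d • m • x₀ = m • x₀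
        rw [hc, ← mul_smul, mul_comm, mul_smul, hd]
      refine isotypicPart_eq_zero_of_apply_ne_one hld fun g => ?_
      have hπ : ∀ g : L, orbitChar L x₀ (g * d) = orbitChar L x₀ g := by
        intro g
        refine Finset.sum_congr rfl fun x _ => ?_
        by_cases hx : x ∈ MulAction.orbit L x₀
        · rw [mul_smul, hdx x hx]
        · simp only [if_neg hx, ite_self]
      simp only [isotypicPart]
      congr 1
      refine finsum_congr fun c => ?_
      rw [mul_assoc, ← Subgroup.coe_mul, mul_comm d c, Subgroup.coe_mul, ← mul_assoc, hπ]

open scoped Classical in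
/-- The permutation character of a subgroup on the cosets of `H`. -/
noncomputable def cosetChar (H L : Subgroup G) [Fintype (G ⧸ H)] (g : L) : ℂ :=
  ∑ x : G ⧸ H, if g • x = x then 1 else 0

theorem cosetChar_mem (H L : Subgroup G) [Fintype (G ⧸ H)] : cosetChar H L ∈ virtualChar L := by
  classical
  exact sum_fixed_mem (fun (_ : L) (_ : G ⧸ H) => (1 : ℂ)) (fun _ _ _ _ => rfl) _
    fun x => indFun_mem _ virtualChar_one

/-- A `p`-subgroup of the stabilizer of `x` fixes `x` and, being conjugate into `T`, also a
translate of `x₀`; these differ when `x` is outside the orbit of `x₀`. -/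
theorem cosetChar_sub_orbitChar_mem (T : Sylow p L) {x₀ : G ⧸ H} (hT : ∀ t ∈ T, t • x₀ = x₀) :
    cosetChar H L - orbitChar L x₀ ∈ indSpan p H L.subtype := by
  classical
  have e : cosetChar H L - orbitChar L x₀ = fun g => ∑ x : G ⧸ H, if g • x = x then
      (if x ∈ MulAction.orbit L x₀ then (0 : ℂ) else 1) else 0 := by
    funext g
    rw [Pi.sub_apply, cosetChar, orbitChar, ← Finset.sum_sub_distrib]
    refine Finset.sum_congr rfl fun x _ => ?_
    split_ifs <;> simp
  rw [e]
  refine sum_fixed_mem_indSpan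
    (fun (_ : L) x => if x ∈ MulAction.orbit L x₀ then (0 : ℂ) else 1) ?_ ?_ ?_
  · intro h g x _
    simp only [smul_mem_orbit_iff]
  · intro x
    simp only [← ite_not (x ∈ MulAction.orbit L x₀) (1 : ℂ) 0]
    exact constant_mem _
  · intro x
    by_cases hx : x ∈ MulAction.orbit L x₀
    · exact Or.inl fun _ _ => if_pos hx
    · right
      intro R hR
      obtain ⟨k, hk⟩ := exists_conj_mem_sylow T (hR.map (MulAction.stabilizer L x).subtype)
      refine ⟨x, k • x₀, ?_, fun r hr => ⟨r.2, ?_⟩⟩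
      · rintro rfl
        exact hx ⟨k, rfl⟩
      · have := hT _ (hk r (Subgroup.mem_map_of_mem _ hr))
        have h2 : (r : L) • k • x₀ = k • x₀ := by
          simpa [mul_smul, inv_smul_eq_iff] using this
        exact h2

theorem cosetChar_sub_one_mem (P : Sylow p G) (hPH : (P : Subgroup G) ≤ H) {q : ℕ}
    [Fact q.Prime] (C : Subgroup L) [C.Normal] [IsMulCommutative C]
    (hcop : (Nat.card C).Coprime q) (hLC : IsPGroup q (L ⧸ C)) :
    cosetChar H L - 1 ∈ indSpan p H L.subtype := by
  classical
  obtain ⟨T⟩ : Nonempty (Sylow p L) := inferInstance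
  by_cases htwo : ∃ y z : G ⧸ H, y ≠ z ∧ ∀ r ∈ T, r • y = y ∧ r • z = z
  · obtain ⟨y, z, hyz, h⟩ := htwo
    exact mem_indSpan_of_fixesTwo (fixesTwo_of_sylow L.subtype T hyz h)
      (sub_mem (cosetChar_mem H L) virtualChar_one)
  obtain ⟨x₀, hT⟩ : ∃ x₀ : G ⧸ H, ∀ t ∈ T, t • x₀ = x₀ := by
    obtain ⟨g, hg⟩ := exists_conj_mem_sylow P (T.2.map L.subtype)
    refine ⟨(g : G ⧸ H), fun t ht => ?_⟩
    change ((t * g : G) : G ⧸ H) = g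
    rw [eq_comm, QuotientGroup.eq, ← mul_assoc]
    exact hPH (hg t (Subgroup.mem_map_of_mem _ ht))
  rw [← sub_add_sub_cancel _ (orbitChar L x₀)]
  refine add_mem (cosetChar_sub_orbitChar_mem T hT) ?_
  by_cases hpq : p = q
  · subst hpq
    refine orbitChar_sub_one_mem (C := C) hcop T hT fun l => ?_
    -- The index of `C T` is a power of `p` because of `C` and prime to `p` because of `T`.
    have htop : C ⊔ (T : Subgroup L) = ⊤ := by
      rw [← Subgroup.index_eq_one]
      obtain ⟨n, hn⟩ := IsPGroup.iff_card.1 hLC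
      have h1 : (C ⊔ (T : Subgroup L)).index ∣ p ^ n := by
        rw [← hn]
        exact Subgroup.index_dvd_of_le le_sup_left
      have h2 : ¬ p ∣ (C ⊔ (T : Subgroup L)).index := fun h =>
        T.not_dvd_index (h.trans (Subgroup.index_dvd_of_le le_sup_right))
      obtain ⟨m, -, hm⟩ := (Nat.dvd_prime_pow Fact.out).1 h1
      rw [hm] at h2 ⊢
      cases m with
      | zero => rfl
      | succ m => exact absurd (dvd_pow_self p m.succ_ne_zero) h2
    obtain ⟨c, hc, t, ht, rfl⟩ := Subgroup.mem_sup_of_normal_left.1 (htop ▸ Subgroup.mem_top l)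
    refine ⟨⟨c, hc⟩, ?_⟩
    rw [mul_smul, hT t ht]
    rfl
  -- For `p ≠ q` the `p`-group `T` dies in the `q`-group `L ⧸ C`. It is then characteristic in the
  -- abelian group `C`, hence normal in `L`, and `L` permutes its fixed cosets, of which there is
  -- only one.
  · have hTC : (T : Subgroup L) ≤ C := by
      intro t ht
      obtain ⟨k, hk⟩ := hLC t
      have hk' : t ^ q ^ k ∈ C := by
        rw [← QuotientGroup.eq_one_iff]
        exact hk
      refine mem_of_pow_mem_of_coprime (Nat.Coprime.pow_left k ?_) hk'
      obtain ⟨n, hn⟩ := T.2 ⟨t, ht⟩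
      have hn' : t ^ p ^ n = 1 := congrArg Subtype.val hn
      exact Nat.Coprime.coprime_dvd_right (orderOf_dvd_of_pow_eq_one hn')
        (Nat.Coprime.pow_right n (((Nat.coprime_primes Fact.out Fact.out).2 (Ne.symm hpq))))
    have hnorm : (T : Subgroup L).Normal := by
      have hn : ((T.subtype hTC : Sylow p C) : Subgroup C).Normal := inferInstance
      have hch := (T.subtype hTC).characteristic_of_normal hn
      have : (((T.subtype hTC : Sylow p C) : Subgroup C).map C.subtype).Normal := inferInstance
      rwa [Sylow.coe_subtype, Subgroup.subgroupOf_map_subtype, inf_eq_left.2 hTC] at this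
    have hfix : ∀ l : L, l • x₀ = x₀ := by
      intro l
      by_contra hne
      refine htwo ⟨l • x₀, x₀, hne, fun r hr => ⟨?_, hT r hr⟩⟩
      have := hT _ (hnorm.conj_mem r hr l⁻¹)
      simpa [mul_smul, inv_smul_eq_iff] using this
    have h0 : orbitChar L x₀ - 1 = 0 := by
      funext g
      have horb : ∀ x : G ⧸ H, x ∈ MulAction.orbit L x₀ ↔ x = x₀ := by
        intro x
        constructor
        · rintro ⟨l, rfl⟩
          exact hfix l
        · rintro rfl
          exact MulAction.mem_orbit_self x
      simp only [orbitChar, Pi.sub_apply, Pi.one_apply, Pi.zero_apply, horb]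
      rw [sub_eq_zero, Finset.sum_eq_single x₀]
      · simp [hfix]
      · intro x _ hx
        simp [hx]
      · simp
    rw [h0]
    exact zero_mem _

end

/-! ### The constant function `1` in rings of integer-valued functions -/

/-- A set of integer-valued functions closed under addition and multiplication contains `1` as soon
as at no point all its values are divisible by the same prime. -/
theorem one_mem_of_forall_prime {X : Type*} [Fintype X] (J : AddSubgroup (X → ℤ))
    (hmul : ∀ f ∈ J, ∀ g ∈ J, f * g ∈ J)
    (h : ∀ x : X, ∀ q : ℕ, q.Prime → ∃ f ∈ J, ¬ (q : ℤ) ∣ f x) : 1 ∈ J := by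
  classical
  have hx : ∀ x : X, ∃ f ∈ J, f x = 1 := by
    intro x
    obtain ⟨d, hd⟩ := Int.subgroup_cyclic (J.map (Pi.evalAddMonoidHom (fun _ : X => ℤ) x))
    rw [← AddSubgroup.zmultiples_eq_closure] at hd
    have hd1 : d.natAbs = 1 := by
      by_contra hne
      obtain ⟨q, hq, hqd⟩ := Nat.exists_prime_and_dvd hne
      obtain ⟨f, hf, hfx⟩ := h x q hq
      have h1 : f x ∈ J.map (Pi.evalAddMonoidHom (fun _ : X => ℤ) x) := ⟨f, hf, rfl⟩
      rw [hd, Int.mem_zmultiples_iff] at h1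
      exact hfx ((Int.natCast_dvd.2 hqd).trans h1)
    have h1 : (1 : ℤ) ∈ J.map (Pi.evalAddMonoidHom (fun _ : X => ℤ) x) := by
      rw [hd, Int.mem_zmultiples_iff]
      exact (Int.isUnit_iff_natAbs_eq.2 hd1).dvd
    exact h1
  have key : ∀ s : Finset X, ∃ f ∈ J, ∀ x ∈ s, f x = 1 := by
    intro s
    induction s using Finset.induction_on with
    | empty => exact ⟨0, zero_mem J, by simp⟩
    | insert a s _ ih =>
      obtain ⟨f, hf, hfs⟩ := ih
      obtain ⟨g, hg, hga⟩ := hx a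
      -- This is `1 - (1 - f)(1 - g)`, equal to `1` wherever `f` or `g` is.
      refine ⟨f + g - f * g, sub_mem (add_mem hf hg) (hmul f hf g hg), fun x hxs => ?_⟩
      simp only [Pi.sub_apply, Pi.add_apply, Pi.mul_apply]
      obtain rfl | hxs := Finset.mem_insert.1 hxs
      · rw [hga]
        ring
      · rw [hfs x hxs]
        ring
  obtain ⟨f, hf, h1⟩ := key Finset.univ
  have : f = 1 := funext fun x => h1 x (Finset.mem_univ x)
  exact this ▸ hf

/-! ### Fixed points on the cosets of hyperelementary subgroups -/

/-- On the fixed points of `g ^ q ^ a`, `g` acts with `q`-power order, so its nontrivial cycles have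
length divisible by `q`. -/
theorem card_fixed_modEq {G X : Type*} [Group G] [MulAction G X] [Finite X] {q : ℕ}
    [Fact q.Prime] (g : G) (a : ℕ) :
    Nat.card {x : X // g ^ q ^ a • x = x} ≡ Nat.card {x : X // g • x = x} [MOD q] := by
  classical
  have := Fintype.ofFinite X
  let Y := {x : X // g ^ q ^ a • x = x}
  let f : Function.End Y := fun y => ⟨g • (y : X), by
    rw [← mul_smul, ← pow_succ, pow_succ', mul_smul, y.2]⟩
  have hf : ∀ n : ℕ, ∀ y : Y, (((f ^ n) y : Y) : X) = g ^ n • (y : X) := by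
    intro n
    induction n with
    | zero => intro y; rw [pow_zero, pow_zero, one_smul]; rfl
    | succ n ih =>
      intro y
      rw [pow_succ', pow_succ', mul_smul, ← ih]
      rfl
  have hf1 : f ^ q ^ a = 1 := by
    funext y
    exact Subtype.ext ((hf _ y).trans y.2)
  have h := Equiv.Perm.card_fixedPoints_modEq hf1
  rw [← Nat.card_eq_fintype_card, ← Nat.card_eq_fintype_card] at h
  have e : f.fixedPoints ≃ {x : X // g • x = x} :=
    { toFun := fun y => ⟨y.1.1, congrArg Subtype.val y.2⟩
      invFun := fun x => ⟨⟨x.1, by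
        have : ∀ n : ℕ, g ^ n • (x : X) = x := by
          intro n
          induction n with
          | zero => simp
          | succ n ih => rw [pow_succ, mul_smul, x.2, ih]
        exact this _⟩, Subtype.ext x.2⟩
      left_inv := fun y => rfl
      right_inv := fun x => rfl }
  rwa [Nat.card_congr e] at h

/-- Let `c` generate the `q'`-part of `⟨g⟩`, let `N` be the normalizer of `⟨c⟩`, and let `L` be the
preimage of a Sylow `q`-subgroup of `N ⧸ ⟨c⟩`. Modulo `q` one may count fixed points of `c`. It
fixes `x L` iff `x⁻¹ c x ∈ L`; this `q'`-element then lies in `⟨c⟩`, so `x ∈ N`. The count is thus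
`[N : L]`, prime to `q`. -/
theorem exists_hyperelementary {G : Type*} [Group G] [Finite G] {q : ℕ} [hq : Fact q.Prime]
    (g : G) : ∃ (L : Subgroup G) (C : Subgroup L), C.Normal ∧ IsMulCommutative C ∧
      (Nat.card C).Coprime q ∧ (∀ _ : C.Normal, IsPGroup q (L ⧸ C)) ∧
      ¬ q ∣ Nat.card {z : G ⧸ L // g • z = z} := by
  classical
  set a := (orderOf g).factorization q with ha
  set c := g ^ q ^ a with hc
  have hco : q.Coprime (orderOf c) := by
    rw [hc, orderOf_pow, Nat.gcd_eq_right (Nat.ordProj_dvd _ _)]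
    exact Nat.coprime_ordCompl hq.out (orderOf_pos g).ne'
  set C₀ := Subgroup.zpowers c with hC₀
  set N := Subgroup.normalizer (C₀ : Set G) with hN
  have hC₀N : C₀ ≤ N := Subgroup.le_normalizer
  have hnorm : (C₀.subgroupOf N).Normal := Subgroup.normal_in_normalizer
  obtain ⟨Q⟩ : Nonempty (Sylow q (N ⧸ C₀.subgroupOf N)) := inferInstance
  set L₁ : Subgroup N := (Q : Subgroup (N ⧸ C₀.subgroupOf N)).comap
    (QuotientGroup.mk' (C₀.subgroupOf N)) with hL₁
  set L : Subgroup G := L₁.map N.subtype with hL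
  have hLN : L ≤ N := by
    rintro _ ⟨n, -, rfl⟩
    exact n.2
  have hLN₁ : L.subgroupOf N = L₁ := Subgroup.comap_map_eq_self_of_injective N.subtype_injective L₁
  have hC₀L : C₀ ≤ L := by
    intro x hx
    refine ⟨⟨x, hC₀N hx⟩, ?_, rfl⟩
    have : QuotientGroup.mk' (C₀.subgroupOf N) ⟨x, hC₀N hx⟩ = 1 :=
      (QuotientGroup.eq_one_iff _).2 hx
    change QuotientGroup.mk' (C₀.subgroupOf N) ⟨x, hC₀N hx⟩ ∈ (Q : Subgroup _)
    rw [this]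
    exact one_mem _
  have hpow : ∀ l ∈ L, ∃ k : ℕ, l ^ q ^ k ∈ C₀ := by
    rintro _ ⟨n, hn, rfl⟩
    obtain ⟨k, hk⟩ := Q.2 ⟨_, hn⟩
    refine ⟨k, ?_⟩
    have h1 : QuotientGroup.mk' (C₀.subgroupOf N) (n ^ q ^ k) = 1 := by
      rw [map_pow]
      exact congrArg Subtype.val hk
    exact (QuotientGroup.eq_one_iff (N := C₀.subgroupOf N) (n ^ q ^ k)).1 h1
  refine ⟨L, C₀.subgroupOf L, ?_, ?_, ?_, ?_, ?_⟩
  · refine ⟨fun x hx l => ?_⟩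
    exact (Subgroup.mem_normalizer_iff.1 (hLN l.2) x).1 hx
  · infer_instance
  · rw [Nat.card_congr (Subgroup.subgroupOfEquivOfLe hC₀L).toEquiv, Nat.card_zpowers]
    exact hco.symm
  · rintro hn ⟨l⟩
    obtain ⟨k, hk⟩ := hpow l l.2
    exact ⟨k, (QuotientGroup.eq_one_iff (l ^ q ^ k)).2 hk⟩
  · have hmod := card_fixed_modEq (X := G ⧸ L) (q := q) g a
    rw [(hmod.symm.dvd_iff dvd_rfl), ← hc]
    have hfix : ∀ z : G ⧸ L, c • z = z ↔ z ∈ MulAction.orbit N ((1 : G) : G ⧸ L) := by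
      have hcoset : ∀ x : G, c • (x : G ⧸ L) = x ↔ x⁻¹ * c * x ∈ L := by
        intro x
        change ((c * x : G) : G ⧸ L) = x ↔ _
        rw [eq_comm, QuotientGroup.eq, mul_assoc]
      intro z
      constructor
      · obtain ⟨x, rfl⟩ := QuotientGroup.mk_surjective z
        rw [hcoset]
        intro hx
        obtain ⟨k, hk⟩ := hpow _ hx
        have hord : orderOf (x⁻¹ * c * x) = orderOf c := by
          have := orderOf_injective (MulAut.conj x⁻¹).toMonoidHom (MulAut.conj x⁻¹).injective c
          simpa using this
        have hxC : x⁻¹ * c * x ∈ C₀ :=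
          mem_of_pow_mem_of_coprime (hord ▸ hco.pow_left k) hk
        have hxN : x⁻¹ ∈ N := by
          have := Fintype.ofFinite C₀
          refine Subgroup.mem_normalizer_fintype ?_
          rintro _ ⟨i, rfl⟩
          have : x⁻¹ * c ^ i * (x⁻¹)⁻¹ = (x⁻¹ * c * x) ^ i := by
            have := conj_zpow (i := i) (a := x⁻¹) (b := c)
            rw [inv_inv] at this
            rw [inv_inv, this]
          change x⁻¹ * c ^ i * (x⁻¹)⁻¹ ∈ C₀
          rw [this]
          exact C₀.zpow_mem hxC i
        refine ⟨⟨x, (inv_mem_iff).1 hxN⟩, ?_⟩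
        change ((x * 1 : G) : G ⧸ L) = x
        rw [mul_one]
      · rintro ⟨n, rfl⟩
        have h1 : n • ((1 : G) : G ⧸ L) = ((n : G) : G ⧸ L) := by
          change ((n * 1 : G) : G ⧸ L) = _
          rw [mul_one]
        change c • (n • ((1 : G) : G ⧸ L)) = n • ((1 : G) : G ⧸ L)
        rw [h1, hcoset]
        refine hC₀L ?_
        have := (Subgroup.mem_normalizer_iff.1 (inv_mem n.2) c).1 (Subgroup.mem_zpowers c)
        simpa using this
    have hcard : Nat.card {z : G ⧸ L // c • z = z} = L₁.index := by
      rw [Nat.card_congr (Equiv.subtypeEquivRight hfix)]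
      change Nat.card (MulAction.orbit N ((1 : G) : G ⧸ L)) = _
      rw [Nat.card_coe_set_eq, ← MulAction.index_stabilizer, ← hLN₁]
      congr 1
      ext n
      rw [MulAction.mem_stabilizer_iff, Subgroup.mem_subgroupOf]
      change ((n * 1 : G) : G ⧸ L) = _ ↔ _
      rw [mul_one, eq_comm, QuotientGroup.eq, inv_one, one_mul]
    rw [hcard, hL₁, Subgroup.index_comap_of_surjective _ (QuotientGroup.mk'_surjective _)]
    exact Q.not_dvd_index

/-! ### The trivial character -/

section

variable {G : Type*} [Group G] [Finite G] {p : ℕ} [Fact p.Prime]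

open scoped Classical in
theorem indFun_one_apply (L : Subgroup G) [Fintype (G ⧸ L)] (g : G) :
    indFun L 1 g = ∑ z : G ⧸ L, if g • z = z then 1 else 0 := by
  rw [indFun_eq_sum virtualChar_one]
  refine Finset.sum_congr rfl fun z _ => ?_
  split_ifs with h
  · exact extFun_of_mem ((out_conj_mem_iff g z).2 h)
  · rfl

theorem indFun_one_sub_one_mem (P : Sylow p G) {H : Subgroup G} (hPH : (P : Subgroup G) ≤ H) :
    indFun H 1 - 1 ∈ indSpan p H (MonoidHom.id G) := by
  classical
  have := Fintype.ofFinite G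
  have := Fintype.ofFinite (G ⧸ H)
  set θ : G → ℂ := indFun H 1 - 1 with hθ
  have hθvc : θ ∈ virtualChar G := sub_mem (indFun_mem H virtualChar_one) virtualChar_one
  let cast : (G → ℤ) →+ (G → ℂ) := (Int.castAddHom ℂ).compLeft G
  have hcast : ∀ f h : G → ℤ, cast (f * h) = cast f * cast h := by
    intro f h
    funext x
    simp [cast]
  -- Requiring `f` itself to be a virtual character gives closure under products: `f h θ = f (h θ)`
  -- stays in the ideal.
  let J : AddSubgroup (G → ℤ) := (virtualChar G ⊓
    (indSpan p H (MonoidHom.id G)).comap (AddMonoidHom.mulRight θ)).comap cast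
  have hJ : ∀ f, f ∈ J ↔ cast f ∈ virtualChar G ∧
    cast f * θ ∈ indSpan p H (MonoidHom.id G) := fun f => Iff.rfl
  have h1 : (1 : G → ℤ) ∈ J := by
    refine one_mem_of_forall_prime J (fun f hf h hh => ?_) fun g q hq => ?_
    · rw [hJ] at *
      rw [hcast]
      refine ⟨virtualChar_mul hf.1 hh.1, ?_⟩
      rw [mul_assoc, mul_comm]
      exact mul_mem_indSpan hh.2 hf.1
    · have : Fact q.Prime := ⟨hq⟩
      obtain ⟨L, C, hCn, hCc, hcop, hLC, hndvd⟩ := exists_hyperelementary (q := q) g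
      have := Fintype.ofFinite (G ⧸ L)
      let f : G → ℤ := fun g => (Nat.card {z : G ⧸ L // g • z = z} : ℤ)
      have hf : cast f = indFun L 1 := by
        funext g
        rw [indFun_one_apply]
        simp [cast, f, Fintype.card_subtype]
      refine ⟨f, (hJ f).2 ⟨?_, ?_⟩, ?_⟩
      · rw [hf]
        exact indFun_mem L virtualChar_one
      · rw [hf, ← indFun_mul_res _ hθvc, one_mul]
        refine indFun_mem_indSpan_of_mem ?_
        have : resFun L θ = cosetChar H L - 1 := by
          funext l
          change indFun H 1 (l : G) - 1 = cosetChar H L l - 1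
          rw [indFun_one_apply]
          rfl
        rw [this]
        exact cosetChar_sub_one_mem P hPH C hcop (hLC hCn)
      · simpa [f, Int.natCast_dvd_natCast] using hndvd
  have h2 := ((hJ 1).1 h1).2
  have h3 : cast 1 = 1 := by
    funext x
    simp [cast]
  rwa [h3, one_mul] at h2

end

end McKay

/-! ### The correspondence between `G` and `H` -/

theorem theorem1p3 {G : Type*} [Group G] [Finite G] (p : ℕ) [Fact p.Prime]
    (P : Sylow p G) (H : Subgroup G) (hH : Subgroup.normalizer (P : Set G) ≤ H)
    (S : Set (Subgroup G)) (hS : S = McKay.intersectionSet (P : Subgroup G) H)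
    (IG : AddSubgroup (McKay.virtualChar G))
    (hIG : IG = McKay.inducedSubgroup p (P : Subgroup G) S)
    (IH : AddSubgroup (McKay.virtualChar H))
    (hIH : IH = McKay.inducedSubgroup p ((P : Subgroup G).subgroupOf H) (McKay.familyIn H S)) :
    (∀ φ ∈ IH, McKay.ind H φ ∈ IG) ∧
    (∀ χ ∈ IG, McKay.res H χ ∈ IH) ∧
    ∃ e : (McKay.virtualChar G ⧸ IG) ≃+ (McKay.virtualChar H ⧸ IH),
      (∀ χ : McKay.virtualChar G,
        e (QuotientAddGroup.mk χ) = QuotientAddGroup.mk (McKay.res H χ)) ∧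
      (∀ φ : McKay.virtualChar H,
        e.symm (QuotientAddGroup.mk φ) = QuotientAddGroup.mk (McKay.ind H φ)) := by
  have hPH : (P : Subgroup G) ≤ H := Subgroup.le_normalizer.trans hH
  have hmemG : ∀ χ : McKay.virtualChar G,
      χ ∈ IG ↔ (χ : G → ℂ) ∈ McKay.indSpan p H (MonoidHom.id G) := by
    intro χ
    have hSG : S = {Q | Q.map (MonoidHom.id G) ∈ McKay.intersectionSet (P : Subgroup G) H} := by
      rw [hS]
      simp only [Subgroup.map_id, Set.ofPred_mem_eq]
    rw [hIG, hSG]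
    exact ⟨McKay.mem_indSpan_of_mem_inducedSubgroup P hPH _ _,
      McKay.mem_inducedSubgroup_of_mem_indSpan P hPH _ P (Subgroup.map_id _)⟩
  have hmemH : ∀ φ : McKay.virtualChar H,
      φ ∈ IH ↔ (φ : H → ℂ) ∈ McKay.indSpan p H H.subtype := by
    intro φ
    rw [hIH, hS]
    refine ⟨McKay.mem_indSpan_of_mem_inducedSubgroup P hPH _ _,
      McKay.mem_inducedSubgroup_of_mem_indSpan P hPH H.subtype (P.subtype hPH) ?_⟩
    rw [Sylow.coe_subtype, Subgroup.subgroupOf_map_subtype, inf_eq_left.2 hPH]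
  have hind : ∀ φ ∈ IH, McKay.ind H φ ∈ IG := fun φ hφ =>
    (hmemG _).2 (McKay.indFun_mem_indSpan_of_mem ((hmemH φ).1 hφ))
  have hres : ∀ χ ∈ IG, McKay.res H χ ∈ IH := fun χ hχ =>
    (hmemH _).2 (McKay.resFun_mem_indSpan ((hmemG χ).1 hχ))
  refine ⟨hind, hres, AddMonoidHom.toAddEquiv
    (QuotientAddGroup.map IG IH (McKay.res H) hres)
    (QuotientAddGroup.map IH IG (McKay.ind H) hind) ?_ ?_, fun χ => rfl, fun φ => rfl⟩
  · ext χ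
    change (QuotientAddGroup.mk (McKay.ind H (McKay.res H χ)) : McKay.virtualChar G ⧸ IG) =
      QuotientAddGroup.mk χ
    rw [eq_comm, QuotientAddGroup.eq, hmemG]
    -- By the projection formula, `(Ind 1 - 1) χ = Ind Res χ - χ`.
    have h := McKay.mul_mem_indSpan (McKay.indFun_one_sub_one_mem P hPH) χ.2
    rw [sub_mul, ← McKay.indFun_mul_res _ χ.2, one_mul, one_mul, sub_eq_neg_add] at h
    exact h
  · ext φ
    change (QuotientAddGroup.mk (McKay.res H (McKay.ind H φ)) : McKay.virtualChar H ⧸ IH) =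
      QuotientAddGroup.mk φ
    rw [eq_comm, QuotientAddGroup.eq, hmemH]
    have h := McKay.resFun_indFun_sub_mem (p := p) φ.2
    rw [sub_eq_neg_add] at h
    exact h
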